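/- Conventions. Polytopes are nonempty and convex, and are considered up to combinatorial equivalence. Let $\mathcal P$ be the commutative ring of simple polytopes: the free abelian group on the combinatorial types of simple polytopes, where addition is disjoint union, multiplication is induced by the Cartesian product, and the unit is the point. Let $d$ be the additive operator on $\mathcal P$ sending a polytope to the disjoint union (sum) of its facets. Put $\mathcal P_{\mathbb Q}=\mathcal P\otimes\mathbb Q$ and extend $d$ to it linearly; $d$ is applied to power series in $x$ over $\mathcal P_{\mathbb Q}$ coefficientwise. A connected building set $B$ on $[n+1]=\{1,\dots,n+1\}$ is a collection of nonempty subsets of $[n+1]$ that contains all singletons and $[n+1]$, and contains $S\cup T$ whenever $S,T\in B$ and $S\cap T\ne\varnothing$. Its nestohedron is the Minkowski sum $P_B=\sum_{S\in B}\operatorname{conv}(e_i\mid i\in S)\subset\mathbb R^{n+1}$. For a connected graph on $[n+1]$, the graphical building set consists of the vertex sets that induce connected subgraphs. Let $Pe^n$ (permutohedron) and $St^n$ (stellahedron), $n\ge 0$, be the nestohedra on the graphical building sets of the complete graph and of the star graph on $n+1$ vertices. Let $P_\Gamma^0=P_{Mas}^0$ be a point and $P_\Gamma^1=P_{Mas}^1$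 a segment, and for $n\ge 2$ let $P_\Gamma^n=P_{B(\Gamma,n)}$ and $P_{Mas}^n=P_{B(P,n)}$, where $B(\Gamma,n)$ and $B(P,n)$ are the following building sets on $[n+1]$: - $B(\Gamma,n)$ consists of the singletons, the subsets of $[n]$ with at least two elements, the subsets containing both $1$ and $n+1$, and $[n+1]$; - $B(P,n)$ consists of the singletons, the subsets containing both $1$ and $2$, and the sets $\{1\}\cup J$ with $\varnothing\ne J\subseteq\{3,\dots,n\}$. Define the generating series $$Pe(x)=\sum_{s\ge0}Pe^s\frac{x^{s+1}}{(s+1)!},\quad St(x)=\sum_{s\ge0}St^s\frac{x^s}{s!},\quad P_\Gamma(x)=\sum_{s\ge0}P_\Gamma^{s+1}\frac{x^s}{s!},\quad P_{Mas}(x)=\sum_{s\ge0}P_{Mas}^{s+2}\frac{x^{s+2}}{s!},$$ and their two-parameter extensions $Pe(q,x),St(q,x),P_\Gamma(q,x),P_{Mas}(q,x)\in\mathcal P_{\mathbb Q}[q][[x]]$, obtained by replacing each polytope $P^n$ of the family by $Q(P^n;q)=\sum_{k=0}^n d^k(P^n)\frac{q^k}{k!}$. Theorem. For each of the families $Pe,St,P_\Gamma,P_{Mas}$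 and each $n\ge0$, the $n$-th polytope is simple of dimension $n$, and its images under all iterates $d^k$ lie in $\mathcal P$. Moreover, the following identities hold. (a) One-parameter identities: $$dP_\Gamma(x)=2Pe(x)P_\Gamma(x)+\Bigl(1+\tfrac{d}{dx}Pe(x)\Bigr)\tfrac{d}{dx}Pe(x),$$ $$dP_{Mas}(x)=(x+Pe(x))P_{Mas}(x)+x^2\Bigl(2\tfrac{d}{dx}St(x)+St(x)P_\Gamma(x)+\tfrac{d}{dx}St(x)\tfrac{d}{dx}Pe(x)\Bigr).$$ (b) $P_\Gamma(q,x)$ is a solution of the Cauchy problem $$\frac{\partial}{\partial q}P_\Gamma(q,x)=2Pe(q,x)P_\Gamma(q,x)+\frac{\partial}{\partial x}Pe(q,x)\Bigl(1+\frac{\partial}{\partial x}Pe(q,x)\Bigr),\qquad P_\Gamma(0,x)=P_\Gamma(x).$$ (c) $P_{Mas}(q,x)$ is a solution of the Cauchy problem $$\frac{\partial}{\partial q}P_{Mas}(q,x)=(x+Pe(q,x))P_{Mas}(q,x)+x^2\Bigl[2\frac{\partial}{\partial x}St(q,x)+St(q,x)P_\Gamma(q,x)+\frac{\partial}{\partial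 x}St(q,x)\frac{\partial}{\partial x}Pe(q,x)\Bigr],\qquad P_{Mas}(0,x)=P_{Mas}(x).$$ -/

import Mathlib

open scoped Pointwise

noncomputable section

/-! Convex polytopes, their faces, and combinatorial types. -/

/-- A (nonempty) convex polytope: the convex hull of a nonempty finite set of points in a real
vector space. -/
structure Polytope where
  /-- the ambient real vector space -/
  Space : Type
  [addCommGroup : AddCommGroup Space]
  [module : Module ℝ Space]
  /-- the underlying set of points -/
  carrier : Set Space
  exists_hull : ∃ s : Set Space, s.Finite ∧ s.Nonempty ∧ carrier = convexHull ℝ s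

attribute [instance] Polytope.addCommGroup Polytope.module

/-- `F` is the face of `P` on which some linear functional attains its minimum over `P`.
For a polytope these are exactly the nonempty faces, `P` itself included (functional `0`). -/
def IsFace {E : Type} [AddCommGroup E] [Module ℝ E] (P F : Set E) : Prop :=
  ∃ l : E →ₗ[ℝ] ℝ, F = {x ∈ P | ∀ y ∈ P, l x ≤ l y}

theorem mem_hull_of_le {E : Type} [AddCommGroup E] [Module ℝ E] {s : Set E} (l : E →ₗ[ℝ] ℝ)
    {c : ℝ} (hs : ∀ v ∈ s, c ≤ l v) {x : E} (hx : x ∈ convexHull ℝ s) :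
    c ≤ l x ∧ (l x = c → x ∈ convexHull ℝ {v ∈ s | l v = c}) := by
  refine convexHull_min (t := {x | c ≤ l x ∧ (l x = c → x ∈ convexHull ℝ {v ∈ s | l v = c})})
    ?_ ?_ hx
  · intro v hv
    exact ⟨hs v hv, fun h => subset_convexHull ℝ _ ⟨hv, h⟩⟩
  · rintro y ⟨hy, hy'⟩ z ⟨hz, hz'⟩ a b ha hb hab
    have e : l (a • y + b • z) = a * l y + b * l z := by simp
    have key : a * l y + b * l z = c + a * (l y - c) + b * (l z - c) := by
      linear_combination c * hab
    have h1 : 0 ≤ a * (l y - c) := mul_nonneg ha (by linarith)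
    have h2 : 0 ≤ b * (l z - c) := mul_nonneg hb (by linarith)
    refine ⟨by rw [e, key]; linarith, fun h => ?_⟩
    rw [e, key] at h
    rcases ha.eq_or_lt with rfl | ha'
    · have : b = 1 := by linarith
      subst this
      simpa using hz' (by linarith)
    · rcases hb.eq_or_lt with rfl | hb'
      · have : a = 1 := by linarith
        subst this
        simpa using hy' (by linarith)
      · have h3 : a * (l y - c) = 0 := by linarith
        have h4 : b * (l z - c) = 0 := by linarith
        have h5 : l y = c := by
          rcases mul_eq_zero.1 h3 with h | h <;> linarith
        have h6 : l z = c := by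
          rcases mul_eq_zero.1 h4 with h | h <;> linarith
        exact convex_convexHull ℝ _ (hy' h5) (hz' h6) ha hb hab

theorem argmin_hull {E : Type} [AddCommGroup E] [Module ℝ E] {s : Set E} (hf : s.Finite)
    (hne : s.Nonempty) (l : E →ₗ[ℝ] ℝ) :
    ∃ c : ℝ, (∀ x ∈ convexHull ℝ s, c ≤ l x) ∧ (∃ v ∈ s, l v = c) ∧
      {x ∈ convexHull ℝ s | ∀ y ∈ convexHull ℝ s, l x ≤ l y} =
        convexHull ℝ {v ∈ s | l v = c} := by
  obtain ⟨v, hv, hmin⟩ := Set.exists_min_image s l hf hne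
  have hc : ∀ x ∈ convexHull ℝ s, l v ≤ l x := fun x hx => (mem_hull_of_le l hmin hx).1
  refine ⟨l v, hc, ⟨v, hv, rfl⟩, ?_⟩
  ext x
  constructor
  · rintro ⟨hx, hx'⟩
    exact (mem_hull_of_le l hmin hx).2 (le_antisymm (hx' v (subset_convexHull ℝ _ hv)) (hc x hx))
  · intro hx
    have hx1 : x ∈ convexHull ℝ s := convexHull_mono (fun w hw => hw.1) hx
    have hx2 : l x = l v := by
      have : x ∈ {y | l y = l v} :=
        convexHull_min (fun w hw => hw.2) (convex_hyperplane l.isLinear _) hx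
      exact this
    exact ⟨hx1, fun y hy => hx2.trans_le (hc y hy)⟩

namespace Polytope

theorem isFace_nonempty (P : Polytope) {F : Set P.Space} (h : IsFace P.carrier F) :
    F.Nonempty := by
  obtain ⟨s, hf, hne, hs⟩ := P.exists_hull
  obtain ⟨l, rfl⟩ := h
  obtain ⟨c, _, ⟨v, hv, hvc⟩, h⟩ := argmin_hull hf hne l
  rw [hs, h]
  exact ⟨v, subset_convexHull ℝ _ ⟨hv, hvc⟩⟩

theorem isFace_hull (P : Polytope) {F : Set P.Space} (h : IsFace P.carrier F) :
    ∃ s : Set P.Space, s.Finite ∧ s.Nonempty ∧ F = convexHull ℝ s := by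
  obtain ⟨s, hf, hne, hs⟩ := P.exists_hull
  obtain ⟨l, rfl⟩ := h
  obtain ⟨c, _, ⟨v, hv, hvc⟩, h⟩ := argmin_hull hf hne l
  refine ⟨{v ∈ s | l v = c}, hf.subset (Set.sep_subset _ _), ⟨v, hv, hvc⟩, ?_⟩
  rw [hs, h]

/-- The product of two order isomorphisms. -/
def prodOrderIso {A A' B B' : Type} [PartialOrder A] [PartialOrder A'] [PartialOrder B]
    [PartialOrder B'] (e : A ≃o A') (f : B ≃o B') : A × B ≃o A' × B' where
  toEquiv := e.toEquiv.prodCongr f.toEquiv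
  map_rel_iff' {a b} := by simp [Prod.le_def]

/-- A one-point poset is a unit for products. -/
def uniqueProdOrderIso (A B : Type) [PartialOrder A] [PartialOrder B] [Unique A] : A × B ≃o B where
  toEquiv := Equiv.uniqueProd B A
  map_rel_iff' {a b} := by simp [Prod.le_def, Subsingleton.elim a.1 b.1]

/-- The poset of nonempty faces of `P`, ordered by inclusion. -/
abbrev Face (P : Polytope) : Type := {F : Set P.Space // IsFace P.carrier F}

instance (P : Polytope) : OrderTop P.Face where
  top := ⟨P.carrier, 0, by simp⟩
  le_top F := by
    obtain ⟨F, l, rfl⟩ := F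
    exact fun x hx => hx.1

instance (P : Polytope) : Finite P.Face := by
  obtain ⟨s, hf, hne, hs⟩ := P.exists_hull
  have key : ∀ F : Set P.Space, IsFace P.carrier F → F = convexHull ℝ (s ∩ F) := by
    rintro F ⟨l, rfl⟩
    obtain ⟨c, hc, ⟨v, hv, hvc⟩, h⟩ := argmin_hull hf hne l
    rw [hs]
    refine Set.Subset.antisymm ?_ ?_
    · conv_lhs => rw [h]
      refine convexHull_mono fun w hw => ⟨hw.1, ?_⟩
      exact ⟨subset_convexHull ℝ _ hw.1, fun y hy => hw.2.trans_le (hc y hy)⟩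
    · refine convexHull_min Set.inter_subset_right ?_
      rw [h]
      exact convex_convexHull ℝ _
  have : Finite (Set.powerset s) := hf.finite_subsets
  refine Finite.of_injective (fun F : P.Face => (⟨s ∩ F.1, Set.inter_subset_left⟩ :
    Set.powerset s)) ?_
  intro F G h
  have h' : s ∩ F.1 = s ∩ G.1 := congrArg Subtype.val h
  exact Subtype.ext (by rw [key F.1 F.2, key G.1 G.2, h'])

/-- A facet of `P`: a maximal proper face. -/
abbrev Facet (P : Polytope) : Type := {F : P.Face // IsCoatom F}

instance (P : Polytope) : Fintype P.Facet := Fintype.ofFinite _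

/-- A face of a polytope, as a polytope. -/
def ofFace (P : Polytope) (F : P.Face) : Polytope where
  Space := P.Space
  carrier := F.1
  exists_hull := P.isFace_hull F.2

theorem isFace_trans (P : Polytope) {F G : Set P.Space} (hF : IsFace P.carrier F)
    (hG : IsFace F G) : IsFace P.carrier G := by
  have hGne : G.Nonempty := (P.ofFace ⟨F, hF⟩).isFace_nonempty hG
  obtain ⟨s, hf, hne, hs⟩ := P.exists_hull
  obtain ⟨l, hl⟩ := hF
  obtain ⟨m, hm⟩ := hG
  obtain ⟨g, hg⟩ := hGne
  have hgF : g ∈ F := by rw [hm] at hg; exact hg.1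
  have hgm : ∀ y ∈ F, m g ≤ m y := by rw [hm] at hg; exact hg.2
  have hgP : g ∈ P.carrier := by rw [hl] at hgF; exact hgF.1
  have hgl : ∀ y ∈ P.carrier, l g ≤ l y := by rw [hl] at hgF; exact hgF.2
  have memF : ∀ y ∈ P.carrier, l y = l g → y ∈ F := by
    intro y hy h
    rw [hl]
    exact ⟨hy, fun z hz => h.trans_le (hgl z hz)⟩
  have sP : ∀ v ∈ s, v ∈ P.carrier := fun v hv => by rw [hs]; exact subset_convexHull ℝ _ hv
  have hev : ∀ v ∈ s, ∀ᶠ ε : ℝ in nhdsWithin 0 (Set.Ioi 0),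
      l g < l v → l g + ε * m g < l v + ε * m v := by
    intro v _
    by_cases h : l g < l v
    · have t1 : Filter.Tendsto (fun ε : ℝ => l g + ε * m g) (nhds 0) (nhds (l g + 0 * m g)) :=
        (Continuous.tendsto (by fun_prop) 0)
      have t2 : Filter.Tendsto (fun ε : ℝ => l v + ε * m v) (nhds 0) (nhds (l v + 0 * m v)) :=
        (Continuous.tendsto (by fun_prop) 0)
      have := t1.eventually_lt t2 (by simpa using h)
      exact (this.filter_mono nhdsWithin_le_nhds).mono fun ε hε _ => hε
    · exact Filter.Eventually.of_forall fun ε h' => absurd h' h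
  have hall := (Filter.eventually_all_finite hf).2 hev
  obtain ⟨ε, hε, hε0⟩ := (hall.and self_mem_nhdsWithin).exists
  have hε0 : 0 < ε := hε0
  have hk : ∀ x, (l + ε • m) x = l x + ε * m x := fun x => by simp
  have hmin : ∀ v ∈ s, l g + ε * m g ≤ (l + ε • m) v := by
    intro v hv
    rw [hk]
    rcases (hgl v (sP v hv)).eq_or_lt with h | h
    · have := mul_le_mul_of_nonneg_left (hgm v (memF v (sP v hv) h.symm)) hε0.le
      linarith
    · exact (hε v hv h).le
  refine ⟨l + ε • m, ?_⟩
  ext x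
  constructor
  · intro hx
    rw [hm] at hx
    obtain ⟨hxF, hxm⟩ := hx
    have h1 : m x = m g := le_antisymm (hxm g hgF) (hgm x hxF)
    rw [hl] at hxF
    have h2 : l x = l g := le_antisymm (hxF.2 g hgP) (hgl x hxF.1)
    refine ⟨hxF.1, fun y hy => ?_⟩
    rw [hs] at hy
    rw [hk x, h1, h2]
    exact (mem_hull_of_le (l + ε • m) hmin hy).1
  · rintro ⟨hxP, hx⟩
    have h1 : (l + ε • m) x = l g + ε * m g := by
      refine le_antisymm ((hx g hgP).trans_eq (hk g)) ?_
      rw [hs] at hxP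
      exact (mem_hull_of_le (l + ε • m) hmin hxP).1
    have h2 : x ∈ convexHull ℝ {v ∈ s | (l + ε • m) v = l g + ε * m g} := by
      have hxP' := hxP
      rw [hs] at hxP'
      exact (mem_hull_of_le (l + ε • m) hmin hxP').2 h1
    have h3 : x ∈ {y | l y = l g} := by
      refine convexHull_min ?_ (convex_hyperplane l.isLinear _) h2
      rintro v ⟨hv, hv'⟩
      rcases (hgl v (sP v hv)).eq_or_lt with h | h
      · exact h.symm
      · have := hε v hv h
        rw [hk] at hv'
        linarith
    have h3 : l x = l g := h3
    rw [hk, h3] at h1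
    have h4 : m x = m g := by
      have : ε * m x = ε * m g := by linarith
      exact mul_left_cancel₀ hε0.ne' this
    rw [hm]
    exact ⟨memF x hxP h3, fun y hy => h4.trans_le (hgm y hy)⟩

theorem isFace_of_subset (P : Polytope) {F G : Set P.Space} (hF : IsFace P.carrier F)
    (hG : IsFace P.carrier G) (h : G ⊆ F) : IsFace F G := by
  obtain ⟨g, hg⟩ := P.isFace_nonempty hG
  obtain ⟨l, hl⟩ := hF
  obtain ⟨m, hm⟩ := hG
  have FP : F ⊆ P.carrier := by rw [hl]; exact fun x hx => hx.1
  refine ⟨m, ?_⟩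
  ext x
  constructor
  · intro hx
    refine ⟨h hx, fun y hy => ?_⟩
    rw [hm] at hx
    exact hx.2 y (FP hy)
  · rintro ⟨hx, hx'⟩
    have h1 := hx' g (h hg)
    rw [hm] at hg ⊢
    exact ⟨FP hx, fun y hy => h1.trans (hg.2 y hy)⟩

/-- The faces of a face `F` are the faces contained in `F`. -/
def ofFaceIso (P : Polytope) (F : P.Face) : (P.ofFace F).Face ≃o Set.Iic F where
  toFun G := ⟨⟨G.1, P.isFace_trans F.2 G.2⟩, by
    obtain ⟨G, l, rfl⟩ := G
    exact fun x hx => hx.1⟩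
  invFun G := ⟨G.1.1, P.isFace_of_subset F.2 G.1.2 G.2⟩
  left_inv _ := rfl
  right_inv _ := rfl
  map_rel_iff' := Iff.rfl

/-- The Cartesian product of two polytopes. -/
def prod (P Q : Polytope) : Polytope where
  Space := P.Space × Q.Space
  carrier := P.carrier ×ˢ Q.carrier
  exists_hull := by
    obtain ⟨s, hf, hne, hs⟩ := P.exists_hull
    obtain ⟨t, hf', hne', ht⟩ := Q.exists_hull
    exact ⟨s ×ˢ t, hf.prod hf', hne.prod hne', by rw [convexHull_prod, hs, ht]⟩

theorem isFace_prod (P Q : Polytope) {F : Set P.Space} {G : Set Q.Space}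
    (hF : IsFace P.carrier F) (hG : IsFace Q.carrier G) :
    IsFace (P.prod Q).carrier (F ×ˢ G : Set (P.Space × Q.Space)) := by
  obtain ⟨f, hf⟩ := P.isFace_nonempty hF
  obtain ⟨g, hg⟩ := Q.isFace_nonempty hG
  obtain ⟨l, rfl⟩ := hF
  obtain ⟨m, rfl⟩ := hG
  refine ⟨l.coprod m, ?_⟩
  have e : ∀ a b, l.coprod m (a, b) = l a + m b := fun a b => LinearMap.coprod_apply _ _ _
  ext ⟨a, b⟩
  constructor
  · rintro ⟨⟨ha, ha'⟩, ⟨hb, hb'⟩⟩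
    refine ⟨⟨ha, hb⟩, ?_⟩
    rintro ⟨c, d⟩ ⟨hc, hd⟩
    exact (e a b).trans_le ((add_le_add (ha' c hc) (hb' d hd)).trans_eq (e c d).symm)
  · rintro ⟨⟨ha, hb⟩, h⟩
    have ha : a ∈ P.carrier := ha
    have hb : b ∈ Q.carrier := hb
    refine ⟨⟨ha, fun y hy => ?_⟩, ⟨hb, fun y hy => ?_⟩⟩
    · have := (e a b).symm.trans_le ((h (y, b) ⟨hy, hb⟩).trans_eq (e y b))
      linarith
    · have := (e a b).symm.trans_le ((h (a, y) ⟨ha, hy⟩).trans_eq (e a y))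
      linarith

theorem exists_of_isFace_prod (P Q : Polytope) {H : Set (P.Space × Q.Space)}
    (hH : IsFace (P.prod Q).carrier H) :
    ∃ F G, IsFace P.carrier F ∧ IsFace Q.carrier G ∧ H = F ×ˢ G := by
  obtain ⟨l, rfl⟩ := hH
  let l1 : P.Space →ₗ[ℝ] ℝ := l ∘ₗ LinearMap.inl ℝ P.Space Q.Space
  let l2 : Q.Space →ₗ[ℝ] ℝ := l ∘ₗ LinearMap.inr ℝ P.Space Q.Space
  have e : ∀ a b, l (a, b) = l1 a + l2 b := by
    intro a b
    have : ((a, b) : P.Space × Q.Space) = (a, 0) + (0, b) := by simp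
    exact (congrArg l this).trans (map_add l _ _)
  refine ⟨_, _, ⟨l1, rfl⟩, ⟨l2, rfl⟩, ?_⟩
  ext ⟨a, b⟩
  constructor
  · rintro ⟨⟨ha, hb⟩, h⟩
    have ha : a ∈ P.carrier := ha
    have hb : b ∈ Q.carrier := hb
    refine ⟨⟨ha, fun y hy => ?_⟩, ⟨hb, fun y hy => ?_⟩⟩
    · have := h (y, b) ⟨hy, hb⟩
      rw [e, e] at this
      linarith
    · have := h (a, y) ⟨ha, hy⟩
      rw [e, e] at this
      linarith
  · rintro ⟨⟨ha, ha'⟩, ⟨hb, hb'⟩⟩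
    refine ⟨⟨ha, hb⟩, ?_⟩
    rintro ⟨c, d⟩ ⟨hc, hd⟩
    rw [e, e]
    exact add_le_add (ha' c hc) (hb' d hd)

/-- The face poset of a product is the product of the face posets. -/
def prodIso (P Q : Polytope) : P.Face × Q.Face ≃o (P.prod Q).Face :=
  RelIso.ofSurjective (r := (· ≤ ·)) (s := (· ≤ ·))
    (OrderEmbedding.ofMapLEIff
      (fun p : P.Face × Q.Face => (⟨p.1.1 ×ˢ p.2.1, P.isFace_prod Q p.1.2 p.2.2⟩ :
        (P.prod Q).Face)) (by
      rintro ⟨F, G⟩ ⟨F', G'⟩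
      have hF := P.isFace_nonempty F.2
      have hG := Q.isFace_nonempty G.2
      constructor
      · intro h
        have h : F.1 ×ˢ G.1 ⊆ F'.1 ×ˢ G'.1 := h
        rcases Set.prod_subset_prod_iff.1 h with h | h | h
        · exact h
        · exact absurd h hF.ne_empty
        · exact absurd h hG.ne_empty
      · rintro ⟨h1, h2⟩
        exact Set.prod_mono h1 h2))
    (by
      rintro ⟨H, hH⟩
      obtain ⟨F, G, hF, hG, rfl⟩ := P.exists_of_isFace_prod Q hH
      exact ⟨(⟨F, hF⟩, ⟨G, hG⟩), rfl⟩)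

/-- The point, as a polytope. -/
def point : Polytope where
  Space := ℝ
  carrier := {0}
  exists_hull := ⟨{0}, by simp, by simp, by simp⟩

/-- The segment `[0, 1]`, as a polytope. -/
def segment : Polytope where
  Space := ℝ
  carrier := Set.Icc 0 1
  exists_hull := ⟨{0, 1}, by simp, by simp, by
    rw [convexHull_pair, segment_eq_Icc zero_le_one]⟩

instance : Unique point.Face where
  default := ⊤
  uniq F := by
    refine le_antisymm le_top ?_
    obtain ⟨x, hx⟩ := point.isFace_nonempty F.2
    have hle : F.1 ⊆ ({0} : Set ℝ) := (le_top : F ≤ ⊤)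
    have h0 : x = (0 : ℝ) := hle hx
    intro y hy
    have hy : y = (0 : ℝ) := hy
    rw [hy, ← h0]
    exact hx

/-- The dimension of a polytope: the dimension of its affine hull. -/
def dim (P : Polytope) : ℕ := Module.finrank ℝ (vectorSpan ℝ P.carrier)

/-- A polytope of dimension `n` is simple if each of its vertices lies on exactly `n` facets. -/
def IsSimple (P : Polytope) : Prop :=
  ∀ v ∈ P.carrier.extremePoints ℝ, {F : P.Facet | v ∈ F.1.1}.ncard = P.dim

/-- Two polytopes are combinatorially equivalent if their face posets are isomorphic. -/
instance combSetoid : Setoid Polytope where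
  r P Q := Nonempty (P.Face ≃o Q.Face)
  iseqv := ⟨fun _ => ⟨OrderIso.refl _⟩, fun ⟨e⟩ => ⟨e.symm⟩, fun ⟨e⟩ ⟨f⟩ => ⟨e.trans f⟩⟩

end Polytope

/-- Combinatorial types of polytopes. -/
def CombType : Type 1 := Quotient Polytope.combSetoid

/-- The combinatorial type of a polytope. -/
def Polytope.type (P : Polytope) : CombType := Quotient.mk _ P

/-- Combinatorial types form a commutative monoid under the Cartesian product, with the point as
unit. -/
instance : CommMonoid CombType where
  mul := Quotient.map₂ Polytope.prod fun P P' ⟨e⟩ Q Q' ⟨f⟩ =>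
    ⟨(P.prodIso Q).symm.trans ((Polytope.prodOrderIso e f).trans (P'.prodIso Q'))⟩
  one := Polytope.point.type
  mul_assoc := by
    rintro ⟨P⟩ ⟨Q⟩ ⟨R⟩
    exact Quotient.sound ⟨((P.prod Q).prodIso R).symm.trans
      ((Polytope.prodOrderIso (P.prodIso Q).symm (OrderIso.refl _)).trans
        ((OrderIso.prodAssoc _ _ _).trans
          ((Polytope.prodOrderIso (OrderIso.refl _) (Q.prodIso R)).trans (P.prodIso (Q.prod R)))))⟩
  one_mul := by
    rintro ⟨P⟩
    exact Quotient.sound ⟨(Polytope.point.prodIso P).symm.trans (Polytope.uniqueProdOrderIso _ _)⟩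
  mul_one := by
    rintro ⟨P⟩
    exact Quotient.sound ⟨(P.prodIso Polytope.point).symm.trans
      (OrderIso.prodComm.trans (Polytope.uniqueProdOrderIso _ _))⟩
  mul_comm := by
    rintro ⟨P⟩ ⟨Q⟩
    exact Quotient.sound ⟨(P.prodIso Q).symm.trans (OrderIso.prodComm.trans (Q.prodIso P))⟩

/-- The ring of polytopes with rational coefficients: formal combinations of combinatorial types
of polytopes, with addition the formal (disjoint) union and multiplication induced by the Cartesian
product. The ring of simple polytopes is the subring `simplePolytopeRing` below. -/
abbrev PolytopeAlg : Type 1 := MonoidAlgebra ℚ CombType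

/-- The class of a polytope in the ring of polytopes. -/
def Polytope.cls (P : Polytope) : PolytopeAlg := MonoidAlgebra.of ℚ CombType P.type

/-- The ring of simple polytopes (with integer coefficients), inside `PolytopeAlg`: it is generated
by the classes of simple polytopes. -/
def simplePolytopeRing : Subring PolytopeAlg :=
  Subring.closure {a | ∃ P : Polytope, P.IsSimple ∧ a = P.cls}

/-- The sum of the classes of all facets of a polytope. -/
def Polytope.facetSum (P : Polytope) : PolytopeAlg := ∑ F : P.Facet, (P.ofFace F.1).cls

theorem Polytope.facetSum_congr (P Q : Polytope) (e : P.Face ≃o Q.Face) :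
    P.facetSum = Q.facetSum := by
  refine Fintype.sum_equiv (e.toEquiv.subtypeEquiv fun F => (e.isCoatom_iff F).symm) _ _ ?_
  intro F
  refine congrArg (MonoidAlgebra.of ℚ CombType) (Quotient.sound ⟨?_⟩)
  refine (P.ofFaceIso F.1).trans (OrderIso.trans ?_ (Q.ofFaceIso (e F.1)).symm)
  exact
    { toEquiv := e.toEquiv.subtypeEquiv fun G => (e.le_iff_le (x := G) (y := F.1)).symm
      map_rel_iff' := fun {a b} => e.le_iff_le }

/-- The sum of the classes of all facets depends only on the combinatorial type. -/
def CombType.facetSum : CombType → PolytopeAlg :=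
  Quotient.lift Polytope.facetSum fun P Q (h : Nonempty (P.Face ≃o Q.Face)) =>
    h.elim (P.facetSum_congr Q)

/-- The operator `d` on the ring of polytopes: the linear operator which sends a polytope to the
disjoint union of its facets. -/
def facetOp : PolytopeAlg →ₗ[ℚ] PolytopeAlg :=
  Finsupp.linearCombination ℚ CombType.facetSum ∘ₗ
    (MonoidAlgebra.coeffLinearEquiv ℚ).toLinearMap

/-! Building sets and nestohedra. -/

/-- A connected building set on a finite set `V`. -/
structure BuildingSet (V : Type) [Fintype V] [DecidableEq V] where
  /-- the elements of the building set -/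
  sets : Finset (Finset V)
  nonempty_of_mem : ∀ S ∈ sets, S.Nonempty
  singleton_mem : ∀ i, {i} ∈ sets
  union_mem : ∀ S ∈ sets, ∀ T ∈ sets, (S ∩ T).Nonempty → S ∪ T ∈ sets
  univ_mem : Finset.univ ∈ sets

/-- The nestohedron on `B`: the Minkowski sum, over the elements `S` of `B`, of the simplices
`conv (e_i | i ∈ S)` in `ℝ^V`. -/
def nestohedron {V : Type} [Fintype V] [DecidableEq V] (B : BuildingSet V) : Polytope where
  Space := V → ℝ
  carrier := ∑ S ∈ B.sets, convexHull ℝ ((fun i : V => (Pi.single i 1 : V → ℝ)) '' (S : Set V))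
  exists_hull := by
    refine ⟨∑ S ∈ B.sets, (fun i : V => (Pi.single i 1 : V → ℝ)) '' (S : Set V), ?_, ?_,
      (convexHull_sum _ _).symm⟩
    · exact Finset.sum_induction _ Set.Finite (fun _ _ => Set.Finite.add) Set.finite_zero
        fun S _ => S.finite_toSet.image _
    · exact Finset.sum_induction _ Set.Nonempty (fun _ _ => Set.Nonempty.add) Set.zero_nonempty
        fun S hS => Set.Nonempty.image _ (Finset.coe_nonempty.2 (B.nonempty_of_mem S hS))

open Classical in
/-- The graphical building set of a connected graph: the sets of vertices which induce a connected
subgraph. -/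
def graphBuildingSet {V : Type} [Fintype V] [DecidableEq V] (G : SimpleGraph V)
    (hG : G.Connected) : BuildingSet V where
  sets := Finset.univ.filter fun S => (G.induce (S : Set V)).Connected
  nonempty_of_mem S hS := by
    obtain ⟨⟨x, hx⟩⟩ := (Finset.mem_filter.1 hS).2.nonempty
    exact ⟨x, hx⟩
  singleton_mem i := by
    refine Finset.mem_filter.2 ⟨Finset.mem_univ _, ?_⟩
    rw [Finset.coe_singleton]
    have : Nonempty ({i} : Set V) := ⟨⟨i, rfl⟩⟩
    exact SimpleGraph.Connected.mk (SimpleGraph.Preconnected.of_subsingleton)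
  union_mem S hS T hT h := by
    refine Finset.mem_filter.2 ⟨Finset.mem_univ _, ?_⟩
    rw [Finset.coe_union]
    refine SimpleGraph.induce_union_connected (Finset.mem_filter.1 hS).2.preconnected
      (Finset.mem_filter.1 hT).2.preconnected ?_
    exact_mod_cast h
  univ_mem := by
    refine Finset.mem_filter.2 ⟨Finset.mem_univ _, ?_⟩
    rw [Finset.coe_univ]
    exact (SimpleGraph.induceUnivIso G).connected_iff.2 hG

/-- The permutohedron `Pe^n`: the graph-associahedron of the complete graph on `n + 1` vertices. -/
def permutohedron (n : ℕ) : Polytope :=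
  nestohedron (graphBuildingSet (⊤ : SimpleGraph (Fin (n + 1))) SimpleGraph.connected_top)

/-- The stellahedron `St^n`: the graph-associahedron of the star graph on `n + 1` vertices. -/
def stellahedron (n : ℕ) : Polytope :=
  nestohedron (graphBuildingSet (SimpleGraph.starGraph (0 : Fin (n + 1)))
    (SimpleGraph.connected_starGraph _))

theorem union_eq_of_card_one {V : Type} [DecidableEq V] (S T : Finset V) (h : (S ∩ T).Nonempty) :
    (S.card = 1 → S ∪ T = T) ∧ (T.card = 1 → S ∪ T = S) := by
  obtain ⟨x, hx⟩ := h
  rw [Finset.mem_inter] at hx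
  constructor
  · intro hc
    obtain ⟨a, rfl⟩ := Finset.card_eq_one.1 hc
    have := Finset.mem_singleton.1 hx.1
    subst this
    exact Finset.union_eq_right.2 (Finset.singleton_subset_iff.2 hx.2)
  · intro hc
    obtain ⟨a, rfl⟩ := Finset.card_eq_one.1 hc
    have := Finset.mem_singleton.1 hx.2
    subst this
    exact Finset.union_eq_left.2 (Finset.singleton_subset_iff.2 hx.1)

/-- The building set `B(Γ, n)` on `{1, …, n + 1}`, where `i` is represented by `i - 1` in
`Fin (n + 1)`. It consists of the singletons, the sets of at least two elements which do not
contain `n + 1`, the sets which contain both `1` and `n + 1`, and the whole set. -/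
def gammaBuildingSet (n : ℕ) : BuildingSet (Fin (n + 1)) where
  sets :=
    Finset.univ.filter (fun S => S.card = 1) ∪
    Finset.univ.filter (fun S => Fin.last n ∉ S ∧ 2 ≤ S.card) ∪
    Finset.univ.filter (fun S => 0 ∈ S ∧ Fin.last n ∈ S) ∪
    {Finset.univ}
  nonempty_of_mem S hS := by
    simp only [Finset.mem_union, Finset.mem_filter, Finset.mem_univ, true_and,
      Finset.mem_singleton] at hS
    rcases hS with ((h | h) | h) | h
    · exact Finset.card_pos.1 (by omega)
    · exact Finset.card_pos.1 (by omega)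
    · exact ⟨0, h.1⟩
    · exact h ▸ Finset.univ_nonempty
  singleton_mem i := by simp
  union_mem S hS T hT h := by
    have key := union_eq_of_card_one S T h
    have h1 := Finset.card_le_card (Finset.subset_union_left (s₁ := S) (s₂ := T))
    have h2 := Finset.mem_union (s := S) (t := T) (a := 0)
    have h3 := Finset.mem_union (s := S) (t := T) (a := Fin.last n)
    have h4 : S = Finset.univ → S ∪ T = Finset.univ := fun e => by simp [e]
    have h5 : T = Finset.univ → S ∪ T = Finset.univ := fun e => by simp [e]
    by_cases c1 : S.card = 1
    · rw [key.1 c1]; exact hT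
    by_cases c2 : T.card = 1
    · rw [key.2 c2]; exact hS
    simp only [Finset.mem_union, Finset.mem_filter, Finset.mem_univ, true_and,
      Finset.mem_singleton] at hS hT h2 h3 ⊢
    grind
  univ_mem := by simp

/-- The building set `B(P, n)` on `{1, …, n + 1}` for `n = m + 2`, where `i` is represented by
`i - 1` in `Fin (n + 1)`. It consists of the singletons, the sets which contain both `1` and `2`,
and the sets of at least two elements which contain `1` but neither `2` nor `n + 1`. -/
def masBuildingSet (m : ℕ) : BuildingSet (Fin (m + 2 + 1)) where
  sets :=
    Finset.univ.filter (fun S => S.card = 1) ∪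
    Finset.univ.filter (fun S => 0 ∈ S ∧ 1 ∈ S) ∪
    Finset.univ.filter (fun S => 0 ∈ S ∧ 1 ∉ S ∧ Fin.last (m + 2) ∉ S ∧ 2 ≤ S.card)
  nonempty_of_mem S hS := by
    simp only [Finset.mem_union, Finset.mem_filter, Finset.mem_univ, true_and] at hS
    rcases hS with (h | h) | h
    · exact Finset.card_pos.1 (by omega)
    · exact ⟨0, h.1⟩
    · exact ⟨0, h.1⟩
  singleton_mem i := by simp
  union_mem S hS T hT h := by
    have key := union_eq_of_card_one S T h
    have h1 := Finset.card_le_card (Finset.subset_union_left (s₁ := S) (s₂ := T))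
    by_cases c1 : S.card = 1
    · rw [key.1 c1]; exact hT
    by_cases c2 : T.card = 1
    · rw [key.2 c2]; exact hS
    simp only [Finset.mem_union, Finset.mem_filter, Finset.mem_univ, true_and] at hS hT ⊢
    grind
  univ_mem := by simp

/-- The family `P_Γ^n`: a point, a segment, and then the nestohedra on `B(Γ, n)`. -/
def gammaPolytope : ℕ → Polytope
  | 0 => Polytope.point
  | 1 => Polytope.segment
  | n + 2 => nestohedron (gammaBuildingSet (n + 2))

/-- The family `P_Mas^n`: a point, a segment, and then the nestohedra on `B(P, n)`. -/
def masPolytope : ℕ → Polytope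
  | 0 => Polytope.point
  | 1 => Polytope.segment
  | m + 2 => nestohedron (masBuildingSet m)

/-! Generating series. -/

/-- The generating series `∑_{s ≥ 0} c_s P^{s + N} x^{s + e}` of a family of polytopes. -/
def genSeries (c : ℕ → ℚ) (N e : ℕ) (P : ℕ → Polytope) : PowerSeries PolytopeAlg :=
  PowerSeries.X ^ e * PowerSeries.mk fun s => c s • (P (s + N)).cls

/-- The polynomial `Q(P^n; q) = ∑_{k = 0}^n (d^k P^n) q^k / k!` in `q`. -/
def qPolynomial (P : ℕ → Polytope) (n : ℕ) : Polynomial PolytopeAlg :=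
  ∑ k ∈ Finset.range (n + 1),
    Polynomial.C ((1 / (k.factorial : ℚ)) • (facetOp^[k]) (P n).cls) * Polynomial.X ^ k

/-- The two-parameter extension `∑_{s ≥ 0} c_s Q(P^{s + N}; q) x^{s + e}` of a generating series,
a formal power series in `x` whose coefficients are polynomials in `q`. -/
def genSeries₂ (c : ℕ → ℚ) (N e : ℕ) (P : ℕ → Polytope) :
    PowerSeries (Polynomial PolytopeAlg) :=
  PowerSeries.X ^ e * PowerSeries.mk fun s => c s • qPolynomial P (s + N)

/-- The operator `d` applied to the coefficients of a power series in `x`. -/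
def facetOpSeries (f : PowerSeries PolytopeAlg) : PowerSeries PolytopeAlg :=
  PowerSeries.mk fun n => facetOp (PowerSeries.coeff n f)

/-- `Pe(x) = ∑ Pe^s x^{s+1} / (s+1)!` -/
def peSeries : PowerSeries PolytopeAlg :=
  genSeries (fun s => 1 / ((s + 1).factorial : ℚ)) 0 1 permutohedron

/-- `St(x) = ∑ St^s x^s / s!` -/
def stSeries : PowerSeries PolytopeAlg :=
  genSeries (fun s => 1 / (s.factorial : ℚ)) 0 0 stellahedron

/-- `P_Γ(x) = ∑ P_Γ^{s+1} x^s / s!` -/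
def gammaSeries : PowerSeries PolytopeAlg :=
  genSeries (fun s => 1 / (s.factorial : ℚ)) 1 0 gammaPolytope

/-- `P_Mas(x) = ∑ P_Mas^{s+2} x^{s+2} / s!` -/
def masSeries : PowerSeries PolytopeAlg :=
  genSeries (fun s => 1 / (s.factorial : ℚ)) 2 2 masPolytope

/-- `Pe(q, x)` -/
def peSeries₂ : PowerSeries (Polynomial PolytopeAlg) :=
  genSeries₂ (fun s => 1 / ((s + 1).factorial : ℚ)) 0 1 permutohedron

/-- `St(q, x)` -/
def stSeries₂ : PowerSeries (Polynomial PolytopeAlg) :=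
  genSeries₂ (fun s => 1 / (s.factorial : ℚ)) 0 0 stellahedron

/-- `P_Γ(q, x)` -/
def gammaSeries₂ : PowerSeries (Polynomial PolytopeAlg) :=
  genSeries₂ (fun s => 1 / (s.factorial : ℚ)) 1 0 gammaPolytope

/-- `P_Mas(q, x)` -/
def masSeries₂ : PowerSeries (Polynomial PolytopeAlg) :=
  genSeries₂ (fun s => 1 / (s.factorial : ℚ)) 2 2 masPolytope

/-- `d/dx` on one-parameter series. -/
def ddx (f : PowerSeries PolytopeAlg) : PowerSeries PolytopeAlg :=
  PowerSeries.derivative PolytopeAlg f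

/-- `∂/∂x` on two-parameter series. -/
def partialX (f : PowerSeries (Polynomial PolytopeAlg)) : PowerSeries (Polynomial PolytopeAlg) :=
  PowerSeries.derivative (Polynomial PolytopeAlg) f

/-- `∂/∂q` on two-parameter series. -/
def partialQ (f : PowerSeries (Polynomial PolytopeAlg)) : PowerSeries (Polynomial PolytopeAlg) :=
  PowerSeries.mk fun n => Polynomial.derivative (PowerSeries.coeff n f)

/-- The value at `q = 0` of a two-parameter series. -/
def atQZero (f : PowerSeries (Polynomial PolytopeAlg)) : PowerSeries PolytopeAlg :=
  PowerSeries.map (Polynomial.evalRingHom 0) f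

end

/-! Generalities on order isomorphisms and faces of Minkowski sums of simplices. -/

/-! Geometry is first replaced by combinatorics. A face of a Minkowski sum of simplices `Δ_T`, `T ∈
F`, is cut out by a weight `w` on the vertices: it is the sum of the simplices on the sets `argmin w
T`. One such face lies in another exactly when every `argmin` set of the first lies in that of the
second (`minSet_subset_iff`). So the face poset is the poset quotient of a preorder on weights, and
isomorphisms of face posets are obtained by comparing preorders.

For a connected building set on `W`, the facets are the faces of the indicator weights of the
members `S ≠ W` (`IsBuilding.facetEquiv`). The facet of `S` is the product of the nestohedra of the
restriction to `S` and of the contraction by `S` (`cls_ofFace_indicatorOf`). Hence `d` of a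
nestohedron is a sum of products over its proper members (`IsBuilding.facetOp_cls`). A vertex has
one minimiser in each member, and counting members by their minimisers gives simplicity
(`IsBuilding.card_filter_refines`).

For the families `Γ` and `Mas`, the restrictions and contractions again belong to the four families.
Sorting the members `S` by the distinguished vertices they contain leaves sums over subsets `J` of
the other vertices which depend only on the size of `J` (`facetOp_gammaFam`, `facetOp_masFam`). Such
sums are binomial convolutions, that is, products of exponential generating series
(`coeff_egf_mul`). This gives the one-parameter identities.

For two parameters, `d` is a derivation because of the shape of the facets of a product, so `exp(q
d)` is a ring homomorphism with `∂/∂q exp(q d) = exp(q d) d` (`expHom`, `derivative_expSeries`).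
Since `d^k` kills an `n`-dimensional nestohedron for `k > n` (`iterate_facetOp_eq_zero`), the
polynomial `Q(P; q)` is the whole exponential. Applying `exp(q d)` to the one-parameter identities
yields the Cauchy problems. -/

/-- Two surjections onto posets which induce the same preorder on their domain give an order
isomorphism. -/
noncomputable def orderIsoOfSurjective {L A B : Type*} [PartialOrder A] [PartialOrder B]
    (f : L → A) (g : L → B) (hf : Function.Surjective f) (hg : Function.Surjective g)
    (h : ∀ l l', f l ≤ f l' ↔ g l ≤ g l') : A ≃o B :=
  RelIso.ofSurjective (r := (· ≤ ·)) (s := (· ≤ ·))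
    (OrderEmbedding.ofMapLEIff (fun a => g (Function.surjInv hf a)) (by
      intro a b
      rw [← h, Function.surjInv_eq hf, Function.surjInv_eq hf]))
    (by
      intro b
      obtain ⟨l, rfl⟩ := hg b
      refine ⟨f l, le_antisymm ?_ ?_⟩
      · exact (h _ _).1 (Function.surjInv_eq hf _).le
      · exact (h _ _).1 (Function.surjInv_eq hf _).ge)

/-! ### Faces of a sum of simplices, encoded by weights on the vertices. -/

section weights

set_option linter.unusedSectionVars false

variable {V : Type} [Fintype V] [DecidableEq V]

/-- The elements of `T` at which the weight `w` is minimal. -/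
noncomputable def argmin (w : V → ℝ) (T : Finset V) : Finset V :=
  T.filter fun i => ∀ j ∈ T, w i ≤ w j

theorem mem_argmin {w : V → ℝ} {T : Finset V} {i : V} :
    i ∈ argmin w T ↔ i ∈ T ∧ ∀ j ∈ T, w i ≤ w j := by
  classical
  simp [argmin]

theorem argmin_subset (w : V → ℝ) (T : Finset V) : argmin w T ⊆ T := Finset.filter_subset _ _

theorem argmin_nonempty (w : V → ℝ) {T : Finset V} (h : T.Nonempty) : (argmin w T).Nonempty := by
  obtain ⟨i, hi, h⟩ := Finset.exists_min_image T w h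
  exact ⟨i, mem_argmin.2 ⟨hi, h⟩⟩

/-- The simplex with vertices `e_i`, `i ∈ T`. -/
def simplexOn (T : Finset V) : Set (V → ℝ) :=
  convexHull ℝ ((fun i : V => (Pi.single i 1 : V → ℝ)) '' (T : Set V))

/-- The linear functional with weights `w`. -/
def weightFun (w : V → ℝ) : (V → ℝ) →ₗ[ℝ] ℝ := ∑ i, w i • LinearMap.proj i

theorem weightFun_apply (w x : V → ℝ) : weightFun w x = ∑ i, w i * x i := by
  simp [weightFun]

@[simp]
theorem weightFun_single (w : V → ℝ) (i : V) : weightFun w (Pi.single i 1) = w i := by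
  simp [weightFun_apply, Pi.single_apply]

/-- This is why weights parametrise all faces (`faceOf_surjective`). -/
theorem eq_weightFun (l : (V → ℝ) →ₗ[ℝ] ℝ) : l = weightFun fun i => l (Pi.single i 1) := by
  refine LinearMap.pi_ext' fun i => LinearMap.ext_ring ?_
  simp

/-- The points of `K` at which the functional with weights `w` is minimal. -/
def minSet (w : V → ℝ) (K : Set (V → ℝ)) : Set (V → ℝ) :=
  {x ∈ K | ∀ y ∈ K, weightFun w x ≤ weightFun w y}

theorem single_mem_simplexOn {T : Finset V} {i : V} (h : i ∈ T) :
    (Pi.single i 1 : V → ℝ) ∈ simplexOn T :=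
  subset_convexHull ℝ _ ⟨i, h, rfl⟩

theorem simplexOn_mono {S T : Finset V} (h : S ⊆ T) : simplexOn S ⊆ simplexOn T :=
  convexHull_mono (Set.image_mono (Finset.coe_subset.2 h))

theorem minSet_simplexOn (w : V → ℝ) {T : Finset V} (hT : T.Nonempty) :
    minSet w (simplexOn T) = simplexOn (argmin w T) := by
  obtain ⟨c, hc, ⟨v, ⟨i, hi, rfl⟩, hv⟩, h⟩ := argmin_hull (T.finite_toSet.image
    (fun i : V => (Pi.single i 1 : V → ℝ))) (hT.to_set.image _) (weightFun w)
  refine h.trans (congrArg (convexHull ℝ) ?_)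
  have hc' : ∀ j ∈ T, c ≤ w j := fun j hj => by
    simpa using hc _ (single_mem_simplexOn hj)
  have hv : w i = c := by simpa using hv
  ext x
  constructor
  · rintro ⟨⟨j, hj, rfl⟩, h⟩
    refine ⟨j, Finset.mem_coe.2 (mem_argmin.2 ⟨hj, fun k hk => ?_⟩), rfl⟩
    have h : w j = c := by simpa using h
    exact h ▸ hc' k hk
  · rintro ⟨j, hj, rfl⟩
    obtain ⟨hj, hj'⟩ := mem_argmin.1 (Finset.mem_coe.1 hj)
    refine ⟨⟨j, hj, rfl⟩, ?_⟩
    rw [weightFun_single]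
    exact le_antisymm (hv ▸ hj' i hi) (hc' j hj)

theorem single_mem_minSet {w : V → ℝ} {T : Finset V} {i : V} (hi : i ∈ T) :
    (Pi.single i 1 : V → ℝ) ∈ minSet w (simplexOn T) ↔ i ∈ argmin w T := by
  constructor
  · rintro ⟨-, h⟩
    refine mem_argmin.2 ⟨hi, fun j hj => ?_⟩
    simpa using h _ (single_mem_simplexOn hj)
  · intro h
    rw [minSet_simplexOn w ⟨i, hi⟩]
    exact single_mem_simplexOn h

/-- A sum of points is minimal on a Minkowski sum if and only if each summand is minimal. -/
theorem sum_mem_minSet {ι : Type*} {w : V → ℝ} {I : Finset ι}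
    {K : ι → Set (V → ℝ)} {g : ι → V → ℝ} (hg : ∀ T ∈ I, g T ∈ K T) :
    ∑ T ∈ I, g T ∈ minSet w (∑ T ∈ I, K T) ↔ ∀ T ∈ I, g T ∈ minSet w (K T) := by
  classical
  constructor
  · rintro ⟨-, h⟩ T hT
    refine ⟨hg T hT, fun y hy => ?_⟩
    -- Exchange argument: replacing only the summand at `T` by `y` gives another point of the sum,
    -- so minimality of the total forces minimality of that summand.
    have h1 : ∑ S ∈ I, Function.update g T y S ∈ ∑ T ∈ I, K T := by
      refine (Set.mem_finsetSum _ _ _).2 ⟨_, ?_, rfl⟩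
      intro S hS
      by_cases e : S = T
      · subst e; simpa using hy
      · simpa [e] using hg S hS
    have h2 := h _ h1
    rw [Finset.sum_update_of_mem hT, ← Finset.sum_sdiff (Finset.singleton_subset_iff.2 hT),
      Finset.sum_singleton, map_add, map_add] at h2
    linarith
  · intro h
    refine ⟨(Set.mem_finsetSum _ _ _).2 ⟨g, fun {S} hS => hg S hS, rfl⟩, fun y hy => ?_⟩
    obtain ⟨k, hk, rfl⟩ := (Set.mem_finsetSum _ _ _).1 hy
    rw [map_sum, map_sum]
    exact Finset.sum_le_sum fun T hT => (h T hT).2 _ (hk hT)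

/-- `w` is at least as fine as `w'` on the family `F`. -/
def Refines (F : Finset (Finset V)) (w w' : V → ℝ) : Prop :=
  ∀ T ∈ F, argmin w T ⊆ argmin w' T

/-- The Minkowski sum of the simplices on the nonempty members of a family. -/
def simplexSumSet (F : Finset (Finset V)) : Set (V → ℝ) := ∑ T ∈ F.erase ∅, simplexOn T

/-- A minimal vertex is chosen in every summand, with the choice at `T` prescribed. Such points let
the `argmin` sets be recovered from the face. -/
theorem exists_mem_minSet (w : V → ℝ) {F : Finset (Finset V)} {T : Finset V} (hT : T ∈ F) {i : V}
    (hi : i ∈ argmin w T) : ∃ g : Finset V → V, (∀ S ∈ F.erase ∅, g S ∈ argmin w S) ∧ g T = i ∧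
      ∑ S ∈ F.erase ∅, (Pi.single (g S) 1 : V → ℝ) ∈ minSet w (simplexSumSet F) := by
  have h : ∀ S : Finset V, ∃ j, S ∈ F.erase ∅ → j ∈ argmin w S := by
    intro S
    by_cases hS : S ∈ F.erase ∅
    · obtain ⟨j, hj⟩ := argmin_nonempty w
        (Finset.nonempty_iff_ne_empty.2 (Finset.mem_erase.1 hS).1)
      exact ⟨j, fun _ => hj⟩
    · exact ⟨i, fun h => absurd h hS⟩
  choose g hg using h
  have hg' : ∀ S ∈ F.erase ∅, Function.update g T i S ∈ argmin w S := by
    intro S hS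
    by_cases e : S = T
    · subst e; simpa using hi
    · simpa [e] using hg S hS
  refine ⟨Function.update g T i, hg', by simp, ?_⟩
  refine (sum_mem_minSet fun S hS => ?_).2 fun S hS => ?_
  · exact single_mem_simplexOn (argmin_subset _ _ (hg' S hS))
  · exact (single_mem_minSet (argmin_subset _ _ (hg' S hS))).2 (hg' S hS)

/-- Forwards, inclusion is tested on a sum of vertices whose summand at `T` is the given `i`.
Backwards, a decomposition of a minimal point has minimal summands, and each of these stays minimal
for `w'`. -/
theorem minSet_subset_iff {F : Finset (Finset V)} {w w' : V → ℝ} :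
    minSet w (simplexSumSet F) ⊆ minSet w' (simplexSumSet F) ↔ Refines F w w' := by
  constructor
  · intro h T hT i hi
    obtain ⟨g, hg, rfl, hm⟩ := exists_mem_minSet w hT hi
    have hT' : T ∈ F.erase ∅ := by
      refine Finset.mem_erase.2 ⟨?_, hT⟩
      rintro rfl
      simpa using argmin_subset _ _ hi
    have := (sum_mem_minSet fun S hS =>
      single_mem_simplexOn (argmin_subset _ _ (hg S hS))).1 (h hm) T hT'
    exact (single_mem_minSet (argmin_subset _ _ hi)).1 this
  · intro h x hx
    obtain ⟨g, hg, rfl⟩ := (Set.mem_finsetSum _ _ _).1 hx.1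
    refine (sum_mem_minSet fun T hT => hg hT).2 fun T hT => ?_
    have h1 := (sum_mem_minSet fun T hT => hg hT).1 hx T hT
    have hne := Finset.nonempty_iff_ne_empty.2 (Finset.mem_erase.1 hT).1
    rw [minSet_simplexOn _ hne] at h1 ⊢
    exact simplexOn_mono (h T (Finset.mem_erase.1 hT).2) h1

/-- The Minkowski sum of the simplices on the nonempty members of a family, as a polytope. -/
def simplexSum (F : Finset (Finset V)) : Polytope where
  Space := V → ℝ
  carrier := simplexSumSet F
  exists_hull := by
    refine ⟨∑ S ∈ F.erase ∅, (fun i : V => (Pi.single i 1 : V → ℝ)) '' (S : Set V), ?_, ?_,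
      (convexHull_sum _ _).symm⟩
    · exact Finset.sum_induction _ Set.Finite (fun _ _ => Set.Finite.add) Set.finite_zero
        fun S _ => S.finite_toSet.image _
    · exact Finset.sum_induction _ Set.Nonempty (fun _ _ => Set.Nonempty.add) Set.zero_nonempty
        fun S hS => Set.Nonempty.image _ (Finset.coe_nonempty.2
          (Finset.nonempty_iff_ne_empty.2 (Finset.mem_erase.1 hS).1))

theorem nestohedron_eq_simplexSum (B : BuildingSet V) : nestohedron B = simplexSum B.sets := by
  have h : B.sets.erase ∅ = B.sets :=
    Finset.erase_eq_of_notMem fun h => by simpa using B.nonempty_of_mem ∅ h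
  have h' : simplexSumSet B.sets =
      ∑ S ∈ B.sets, convexHull ℝ ((fun i : V => (Pi.single i 1 : V → ℝ)) '' (S : Set V)) := by
    rw [simplexSumSet, h]
    rfl
  simp only [nestohedron, simplexSum, h']

/-- The face of `simplexSum F` on which the weight `w` is minimal. -/
def faceOf (F : Finset (Finset V)) (w : V → ℝ) : (simplexSum F).Face :=
  ⟨minSet w (simplexSumSet F), weightFun w, rfl⟩

theorem faceOf_surjective (F : Finset (Finset V)) : Function.Surjective (faceOf F) := by
  rintro ⟨G, l, rfl⟩
  have key : ∀ l : (V → ℝ) →ₗ[ℝ] ℝ, ∃ w, minSet w (simplexSumSet F) =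
      {x ∈ simplexSumSet F | ∀ y ∈ simplexSumSet F, l x ≤ l y} := fun l =>
    ⟨fun i => l (Pi.single i 1), by rw [minSet, ← eq_weightFun l]⟩
  obtain ⟨w, hw⟩ := key l
  exact ⟨w, Subtype.ext hw⟩

theorem faceOf_le {F : Finset (Finset V)} {w w' : V → ℝ} :
    faceOf F w ≤ faceOf F w' ↔ Refines F w w' := minSet_subset_iff

theorem faceOf_zero (F : Finset (Finset V)) : faceOf F 0 = ⊤ := by
  refine le_antisymm le_top ?_
  obtain ⟨w, hw⟩ := faceOf_surjective F ⊤
  rw [← hw, faceOf_le]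
  intro T _ i hi
  exact mem_argmin.2 ⟨argmin_subset _ _ hi, by simp⟩

theorem refines_congr_argmin {F : Finset (Finset V)} {w w' : V → ℝ}
    (h : ∀ T ∈ F, argmin w T = argmin w' T) : faceOf F w = faceOf F w' :=
  le_antisymm (faceOf_le.2 fun T hT => (h T hT).subset) (faceOf_le.2 fun T hT => (h T hT).ge)

end weights

/-! ### Facets of a nestohedron and their product structure. -/

section facets

variable {V : Type} [Fintype V] [DecidableEq V]

set_option linter.unusedSectionVars false

/-- Used with `U = T \ S`: once the minimum over `T` is attained only off `S`, the part of `T` in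
`S` plays no role. -/
theorem argmin_eq_of_subset {w : V → ℝ} {T U : Finset V} (h1 : argmin w T ⊆ U) (h2 : U ⊆ T)
    (hT : T.Nonempty) : argmin w U = argmin w T := by
  obtain ⟨k, hk⟩ := argmin_nonempty w hT
  ext i
  constructor
  · intro hi
    have hi := mem_argmin.1 hi
    exact mem_argmin.2 ⟨h2 hi.1, fun j hj => (hi.2 k (h1 hk)).trans ((mem_argmin.1 hk).2 j hj)⟩
  · intro hi
    exact mem_argmin.2 ⟨h1 hi, fun j hj => (mem_argmin.1 hi).2 j (h2 hj)⟩

theorem argmin_congr {w w' : V → ℝ} {T : Finset V}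
    (h : ∀ i ∈ T, ∀ j ∈ T, w i ≤ w j ↔ w' i ≤ w' j) : argmin w T = argmin w' T := by
  ext i
  rw [mem_argmin, mem_argmin]
  exact and_congr_right fun hi => forall₂_congr fun j hj => h i hi j hj

theorem argmin_map {V' : Type} [Fintype V'] [DecidableEq V'] (f : V' ↪ V) (w : V → ℝ)
    (T : Finset V') : argmin w (T.map f) = (argmin (w ∘ f) T).map f := by
  ext i
  simp only [mem_argmin, Finset.mem_map, Function.comp]
  constructor
  · rintro ⟨⟨j, hj, rfl⟩, h⟩
    exact ⟨j, ⟨hj, fun k hk => h _ ⟨k, hk, rfl⟩⟩, rfl⟩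
  · rintro ⟨j, ⟨hj, h⟩, rfl⟩
    refine ⟨⟨j, hj, rfl⟩, ?_⟩
    rintro _ ⟨k, hk, rfl⟩
    exact h k hk

/-- Relabelling the ground set does not change the combinatorial type. -/
theorem cls_simplexSum_map {V' : Type} [Fintype V'] [DecidableEq V'] (f : V' ↪ V)
    (F : Finset (Finset V')) :
    (simplexSum (F.image (Finset.map f))).cls = (simplexSum F).cls := by
  refine congrArg (MonoidAlgebra.of ℚ CombType) (Quotient.sound ⟨?_⟩)
  refine orderIsoOfSurjective (L := V → ℝ) (faceOf _) (fun w => faceOf F (w ∘ f))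
    (faceOf_surjective _) ?_ ?_
  · intro G
    obtain ⟨w, rfl⟩ := faceOf_surjective F G
    -- The value `0` off the image of `f` is arbitrary, as no member of the relabelled family meets
    -- that part.
    exact ⟨Function.extend f w 0, by
      simp only [Function.extend_comp f.injective]⟩
  · intro w w'
    rw [faceOf_le, faceOf_le]
    simp only [Refines, Finset.forall_mem_image, argmin_map, Finset.map_subset_map]

/-- The members of the family contained in `S`. -/
def restrictFam (F : Finset (Finset V)) (S : Finset V) : Finset (Finset V) :=
  F.filter (· ⊆ S)

/-- The traces outside `S` of the members of the family not contained in `S`. -/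
def contractFam (F : Finset (Finset V)) (S : Finset V) : Finset (Finset V) :=
  (F.filter fun T => ¬ T ⊆ S).image (· \ S)

/-- The indicator function of `S`. -/
noncomputable def indicatorOf (S : Finset V) : V → ℝ := fun i => if i ∈ S then 1 else 0

theorem argmin_indicatorOf_of_subset {S T : Finset V} (h : T ⊆ S) :
    argmin (indicatorOf S) T = T := by
  refine (argmin_subset _ _).antisymm fun i hi => mem_argmin.2 ⟨hi, fun j hj => ?_⟩
  simp [indicatorOf, h hi, h hj]

theorem argmin_indicatorOf_of_not_subset {S T : Finset V} (h : ¬ T ⊆ S) :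
    argmin (indicatorOf S) T = T \ S := by
  obtain ⟨k, hk, hk'⟩ := Finset.not_subset.1 h
  ext i
  rw [mem_argmin, Finset.mem_sdiff]
  refine and_congr_right fun hi => ⟨fun h hS => ?_, fun hS j hj => ?_⟩
  · have := h k hk
    norm_num [indicatorOf, hS, hk'] at this
  · simp only [indicatorOf, hS, if_false]
    split_ifs <;> norm_num

/-- On `T ⊆ S` the indicator is constant and imposes nothing; on any other `T` its minimum is `0`,
attained exactly off `S`. -/
theorem refines_indicatorOf {F : Finset (Finset V)} {w : V → ℝ} {S : Finset V} :
    Refines F w (indicatorOf S) ↔ ∀ T ∈ F, ¬ T ⊆ S → argmin w T ⊆ T \ S := by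
  refine forall₂_congr fun T hT => ?_
  by_cases h : T ⊆ S
  · simp [argmin_indicatorOf_of_subset h, h, argmin_subset]
  · simp [argmin_indicatorOf_of_not_subset h, h]

/-- Inside the face of `S`, a member not contained in `S` has the same minimisers as its trace off
`S`. The comparison of two weights therefore splits into members inside `S` and traces outside. -/
theorem refines_iff_restrict_contract {F : Finset (Finset V)} {w w' : V → ℝ} {S : Finset V}
    (hw : Refines F w (indicatorOf S)) (hw' : Refines F w' (indicatorOf S)) :
    Refines F w w' ↔ Refines (restrictFam F S) w w' ∧ Refines (contractFam F S) w w' := by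
  rw [refines_indicatorOf] at hw hw'
  have key : ∀ T ∈ F, ¬ T ⊆ S → argmin w (T \ S) = argmin w T ∧
      argmin w' (T \ S) = argmin w' T := by
    intro T hT h
    obtain ⟨k, hk, -⟩ := Finset.not_subset.1 h
    exact ⟨argmin_eq_of_subset (hw T hT h) Finset.sdiff_subset ⟨k, hk⟩,
      argmin_eq_of_subset (hw' T hT h) Finset.sdiff_subset ⟨k, hk⟩⟩
  constructor
  · intro h
    refine ⟨fun T hT => h T (Finset.mem_filter.1 hT).1, fun T' hT' => ?_⟩
    obtain ⟨T, hT, rfl⟩ := Finset.mem_image.1 hT'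
    obtain ⟨hT, hS⟩ := Finset.mem_filter.1 hT
    rw [(key T hT hS).1, (key T hT hS).2]
    exact h T hT
  · rintro ⟨h1, h2⟩ T hT
    by_cases hS : T ⊆ S
    · exact h1 T (Finset.mem_filter.2 ⟨hT, hS⟩)
    · have := h2 (T \ S) (Finset.mem_image.2 ⟨T, Finset.mem_filter.2 ⟨hT, hS⟩, rfl⟩)
      rwa [(key T hT hS).1, (key T hT hS).2] at this

theorem exists_combine (F : Finset (Finset V)) (S : Finset V) (w₁ w₂ : V → ℝ) :
    ∃ w, Refines F w (indicatorOf S) ∧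
      faceOf (restrictFam F S) w = faceOf (restrictFam F S) w₁ ∧
      faceOf (contractFam F S) w = faceOf (contractFam F S) w₂ := by
  -- `K` exceeds every difference `w₂ j - w₁ i`. Shifting `w₁` by `K` on `S` lifts all of `S` above
  -- its complement without changing comparisons within `S`.
  set K : ℝ := 1 + ∑ i, |w₁ i| + ∑ i, |w₂ i| with hK
  have hlt : ∀ i j, w₂ j < w₁ i + K := by
    intro i j
    have h1 : |w₁ i| ≤ ∑ i, |w₁ i| := Finset.single_le_sum (f := fun i => |w₁ i|)
      (fun i _ => abs_nonneg _) (Finset.mem_univ i)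
    have h2 : |w₂ j| ≤ ∑ i, |w₂ i| := Finset.single_le_sum (f := fun i => |w₂ i|)
      (fun i _ => abs_nonneg _) (Finset.mem_univ j)
    have h3 := neg_abs_le (w₁ i)
    have h4 := le_abs_self (w₂ j)
    linarith
  refine ⟨fun i => if i ∈ S then w₁ i + K else w₂ i, ?_, ?_, ?_⟩
  · refine refines_indicatorOf.2 fun T _ h i hi => ?_
    obtain ⟨k, hk, hk'⟩ := Finset.not_subset.1 h
    obtain ⟨hi, hmin⟩ := mem_argmin.1 hi
    refine Finset.mem_sdiff.2 ⟨hi, fun hiS => ?_⟩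
    have := hmin k hk
    simp only [hiS, hk', if_true, if_false] at this
    exact absurd this (hlt i k).not_ge
  · refine refines_congr_argmin fun T hT => argmin_congr fun i hi j hj => ?_
    have hS := (Finset.mem_filter.1 hT).2
    simp [hS hi, hS hj]
  · refine refines_congr_argmin fun T' hT' => ?_
    obtain ⟨T, -, rfl⟩ := Finset.mem_image.1 hT'
    refine argmin_congr fun i hi j hj => ?_
    simp [(Finset.mem_sdiff.1 hi).2, (Finset.mem_sdiff.1 hj).2]

/-- The face of `simplexSum F` given by the indicator function of `S` is a product. -/
theorem cls_ofFace_indicatorOf (F : Finset (Finset V)) (S : Finset V) :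
    ((simplexSum F).ofFace (faceOf F (indicatorOf S))).cls =
      (simplexSum (restrictFam F S)).cls * (simplexSum (contractFam F S)).cls := by
  rw [Polytope.cls, Polytope.cls, Polytope.cls, ← map_mul]
  refine congrArg (MonoidAlgebra.of ℚ CombType) (Quotient.sound ⟨?_⟩)
  refine ((simplexSum F).ofFaceIso _).trans (OrderIso.trans ?_ (Polytope.prodIso _ _))
  -- The lower interval and the product poset are both images of the weights that refine the
  -- indicator of `S`, with the same induced preorder.
  refine orderIsoOfSurjective (L := {w : V → ℝ // Refines F w (indicatorOf S)})
    (fun w => ⟨faceOf F w.1, faceOf_le.2 w.2⟩)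
    (fun w => (faceOf (restrictFam F S) w.1, faceOf (contractFam F S) w.1)) ?_ ?_ ?_
  · rintro ⟨G, hG⟩
    obtain ⟨w, rfl⟩ := faceOf_surjective F G
    exact ⟨⟨w, faceOf_le.1 hG⟩, rfl⟩
  · rintro ⟨G, H⟩
    obtain ⟨w₁, rfl⟩ := faceOf_surjective _ G
    obtain ⟨w₂, rfl⟩ := faceOf_surjective _ H
    obtain ⟨w, hw, h1, h2⟩ := exists_combine F S w₁ w₂
    exact ⟨⟨w, hw⟩, Prod.ext h1 h2⟩
  · rintro ⟨w, hw⟩ ⟨w', hw'⟩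
    exact (faceOf_le (w := w) (w' := w')).trans ((refines_iff_restrict_contract hw hw').trans
      (and_congr faceOf_le.symm faceOf_le.symm))

/-- `F` is a connected building set on `W`. -/
structure IsBuilding (F : Finset (Finset V)) (W : Finset V) : Prop where
  subset : ∀ S ∈ F, S ⊆ W
  nonempty : ∀ S ∈ F, S.Nonempty
  singleton_mem : ∀ i ∈ W, {i} ∈ F
  union_mem : ∀ S ∈ F, ∀ T ∈ F, (S ∩ T).Nonempty → S ∪ T ∈ F
  self_mem : W ∈ F

theorem BuildingSet.isBuilding (B : BuildingSet V) : IsBuilding B.sets Finset.univ :=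
  ⟨fun _ _ => Finset.subset_univ _, B.nonempty_of_mem, fun i _ => B.singleton_mem i,
    B.union_mem, B.univ_mem⟩

namespace IsBuilding

variable {F : Finset (Finset V)} {W : Finset V}

theorem restrict (h : IsBuilding F W) {S : Finset V} (hS : S ∈ F) :
    IsBuilding (restrictFam F S) S where
  subset T hT := (Finset.mem_filter.1 hT).2
  nonempty T hT := h.nonempty T (Finset.mem_filter.1 hT).1
  singleton_mem i hi := Finset.mem_filter.2
    ⟨h.singleton_mem i (h.subset S hS hi), Finset.singleton_subset_iff.2 hi⟩
  union_mem T hT U hU hne := by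
    obtain ⟨hT, hT'⟩ := Finset.mem_filter.1 hT
    obtain ⟨hU, hU'⟩ := Finset.mem_filter.1 hU
    exact Finset.mem_filter.2 ⟨h.union_mem T hT U hU hne, Finset.union_subset hT' hU'⟩
  self_mem := Finset.mem_filter.2 ⟨hS, subset_rfl⟩

/-- Traces that meet come from members that meet, and the trace of their union is the union of the
traces. The condition `S ≠ W` is what makes `W \ S` a trace. -/
theorem contract (h : IsBuilding F W) {S : Finset V} (hS : S ∈ F) (hSW : S ≠ W) :
    IsBuilding (contractFam F S) (W \ S) where
  subset T' hT' := by
    obtain ⟨T, hT, rfl⟩ := Finset.mem_image.1 hT'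
    exact Finset.sdiff_subset_sdiff (h.subset T (Finset.mem_filter.1 hT).1) subset_rfl
  nonempty T' hT' := by
    obtain ⟨T, hT, rfl⟩ := Finset.mem_image.1 hT'
    exact Finset.sdiff_nonempty.2 (Finset.mem_filter.1 hT).2
  singleton_mem i hi := by
    obtain ⟨hi, hi'⟩ := Finset.mem_sdiff.1 hi
    refine Finset.mem_image.2 ⟨{i}, Finset.mem_filter.2 ⟨h.singleton_mem i hi, by simpa⟩, ?_⟩
    exact Finset.sdiff_eq_self_of_disjoint (by simpa)
  union_mem T' hT' U' hU' hne := by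
    obtain ⟨T, hT, rfl⟩ := Finset.mem_image.1 hT'
    obtain ⟨U, hU, rfl⟩ := Finset.mem_image.1 hU'
    obtain ⟨hT, hT'⟩ := Finset.mem_filter.1 hT
    obtain ⟨hU, hU'⟩ := Finset.mem_filter.1 hU
    refine Finset.mem_image.2 ⟨T ∪ U, Finset.mem_filter.2 ⟨h.union_mem T hT U hU ?_, ?_⟩, ?_⟩
    · exact hne.mono (Finset.inter_subset_inter Finset.sdiff_subset Finset.sdiff_subset)
    · exact fun h' => hT' (Finset.subset_union_left.trans h')
    · exact Finset.union_sdiff_distrib T U S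
  self_mem := Finset.mem_image.2 ⟨W, Finset.mem_filter.2
    ⟨h.self_mem, fun h' => hSW ((h.subset S hS).antisymm h')⟩, rfl⟩

/-- The largest member of the family which contains `i` and on which `w` is at least `w i`. -/
theorem exists_component (h : IsBuilding F W) (w : V → ℝ) {i : V} (hi : i ∈ W) :
    ∃ S ∈ F, i ∈ S ∧ (∀ j ∈ S, w i ≤ w j) ∧
      ∀ T ∈ F, (S ∩ T).Nonempty → ¬ T ⊆ S → ∃ j ∈ T, j ∉ S ∧ w j < w i := by
  obtain ⟨S, hS, hmax⟩ := Finset.exists_max_image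
    (F.filter fun S => i ∈ S ∧ ∀ j ∈ S, w i ≤ w j) Finset.card
    ⟨{i}, Finset.mem_filter.2 ⟨h.singleton_mem i hi, by simp⟩⟩
  obtain ⟨hS, hiS, hle⟩ := Finset.mem_filter.1 hS
  refine ⟨S, hS, hiS, hle, fun T hT hne hTS => ?_⟩
  by_contra! hc
  -- If `T` had no vertex off `S` of weight below `w i`, then `S ∪ T` would compete with `S`, and by
  -- maximality `T` would lie in `S`.
  have := hmax (S ∪ T) (Finset.mem_filter.2 ⟨h.union_mem S hS T hT hne,
    Finset.mem_union_left _ hiS, fun j hj => by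
      by_cases hjS : j ∈ S
      · exact hle j hjS
      · exact hc j ((Finset.mem_union.1 hj).resolve_left hjS) hjS⟩)
  have heq := Finset.eq_of_subset_of_card_le Finset.subset_union_left this
  exact hTS (heq ▸ Finset.subset_union_right)

/-- A member that meets `S` without lying in it has a vertex lighter than everything in `S`, so none
of its minimisers is in `S`. -/
theorem refines_component {w : V → ℝ} {i : V} {S : Finset V}
    (hle : ∀ j ∈ S, w i ≤ w j)
    (hS : ∀ T ∈ F, (S ∩ T).Nonempty → ¬ T ⊆ S → ∃ j ∈ T, j ∉ S ∧ w j < w i) :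
    Refines F w (indicatorOf S) := by
  refine refines_indicatorOf.2 fun T hT hTS k hk => ?_
  obtain ⟨hk, hk'⟩ := mem_argmin.1 hk
  refine Finset.mem_sdiff.2 ⟨hk, fun hkS => ?_⟩
  obtain ⟨j, hj, -, hlt⟩ := hS T hT ⟨k, Finset.mem_inter.2 ⟨hkS, hk⟩⟩ hTS
  have h1 := hk' j hj
  have h2 := hle k hkS
  linarith

/-- A weight defining a proper face is nonconstant on some member `T`. Take `i ∈ T` which is not
minimal: the component of `i` in the region `w ≥ w i` omits a lighter vertex of `T`, hence is not
`W`, and its indicator gives a face above. -/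
theorem exists_le_of_ne_top (h : IsBuilding F W) {w : V → ℝ} (hw : faceOf F w ≠ ⊤) :
    ∃ S ∈ F, S ≠ W ∧ faceOf F w ≤ faceOf F (indicatorOf S) := by
  have h1 : ∃ T ∈ F, ¬ T ⊆ argmin w T := by
    by_contra! hc
    refine hw (top_unique ?_)
    rw [← faceOf_zero, faceOf_le]
    exact fun T hT => (argmin_subset _ _).trans (hc T hT)
  obtain ⟨T, hT, hne⟩ := h1
  obtain ⟨i, hi, hi'⟩ := Finset.not_subset.1 hne
  have h2 : ∃ j ∈ T, w j < w i := by
    by_contra! hc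
    exact hi' (mem_argmin.2 ⟨hi, hc⟩)
  obtain ⟨j, hj, hlt⟩ := h2
  obtain ⟨S, hS, hiS, hle, hmax⟩ := h.exists_component w (h.subset T hT hi)
  refine ⟨S, hS, ?_, faceOf_le.2 (refines_component hle hmax)⟩
  rintro rfl
  exact absurd (hle j (h.subset T hT hj)) hlt.not_ge

theorem faceOf_indicatorOf_ne_top (h : IsBuilding F W) {S : Finset V} (hS : S ∈ F)
    (hSW : S ≠ W) : faceOf F (indicatorOf S) ≠ ⊤ := by
  intro he
  have h1 : Refines F 0 (indicatorOf S) := by rw [← faceOf_le, he]; exact le_top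
  have h2 := refines_indicatorOf.1 h1 W h.self_mem fun h' => hSW ((h.subset S hS).antisymm h')
  obtain ⟨i, hi⟩ := h.nonempty S hS
  exact (Finset.mem_sdiff.1 (h2 (mem_argmin.2 ⟨h.subset S hS hi, by simp⟩))).2 hi

/-- Testing the refinement on `W` gives `S' ⊆ S`. Testing it on `S`, where the indicator of `S` is
constant, would make `S` disjoint from the nonempty `S'` unless `S ⊆ S'`. -/
theorem eq_of_indicatorOf_le (h : IsBuilding F W) {S S' : Finset V} (hS : S ∈ F) (hSW : S ≠ W)
    (hS' : S' ∈ F) (hS'W : S' ≠ W)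
    (hle : faceOf F (indicatorOf S) ≤ faceOf F (indicatorOf S')) : S = S' := by
  have h1 := refines_indicatorOf.1 (faceOf_le.1 hle)
  have h2 : S' ⊆ S := by
    have := h1 W h.self_mem fun h' => hS'W ((h.subset S' hS').antisymm h')
    rw [argmin_indicatorOf_of_not_subset fun h' => hSW ((h.subset S hS).antisymm h')] at this
    intro i hi
    by_contra hiS
    exact (Finset.mem_sdiff.1 (this (Finset.mem_sdiff.2 ⟨h.subset S' hS' hi, hiS⟩))).2 hi
  refine Finset.Subset.antisymm ?_ h2
  by_contra hn
  have h3 := h1 S hS hn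
  rw [argmin_indicatorOf_of_subset subset_rfl] at h3
  obtain ⟨i, hi⟩ := h.nonempty S' hS'
  exact (Finset.mem_sdiff.1 (h3 (h2 hi))).2 hi

/-- A proper face above the face of `S` lies under the face of some proper member `S'`, and the
antichain property forces `S = S'`. -/
theorem isCoatom_indicatorOf (h : IsBuilding F W) {S : Finset V} (hS : S ∈ F) (hSW : S ≠ W) :
    IsCoatom (faceOf F (indicatorOf S)) := by
  refine isCoatom_iff_ge_of_le.2 ⟨h.faceOf_indicatorOf_ne_top hS hSW, fun G hG hle => ?_⟩
  obtain ⟨w, rfl⟩ := faceOf_surjective F G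
  obtain ⟨S', hS', hS'W, hle'⟩ := h.exists_le_of_ne_top hG
  have := h.eq_of_indicatorOf_le hS hSW hS' hS'W (hle.trans hle')
  exact this ▸ hle'

/-- The facets of `simplexSum F` correspond to the proper members of the building set `F`. -/
noncomputable def facetEquiv (h : IsBuilding F W) : F.erase W ≃ (simplexSum F).Facet :=
  Equiv.ofBijective (fun S => ⟨faceOf F (indicatorOf S.1), h.isCoatom_indicatorOf
    (Finset.mem_of_mem_erase S.2) (Finset.ne_of_mem_erase S.2)⟩) (by
    constructor
    · rintro ⟨S, hS⟩ ⟨S', hS'⟩ he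
      have he : faceOf F (indicatorOf S) = faceOf F (indicatorOf S') := congrArg Subtype.val he
      exact Subtype.ext (h.eq_of_indicatorOf_le (Finset.mem_of_mem_erase hS)
        (Finset.ne_of_mem_erase hS) (Finset.mem_of_mem_erase hS') (Finset.ne_of_mem_erase hS')
        he.le)
    · rintro ⟨G, hG⟩
      obtain ⟨w, rfl⟩ := faceOf_surjective F G
      obtain ⟨S, hS, hSW, hle⟩ := h.exists_le_of_ne_top hG.1
      refine ⟨⟨S, Finset.mem_erase.2 ⟨hSW, hS⟩⟩, Subtype.ext ?_⟩
      exact (hG.le_iff_eq (h.faceOf_indicatorOf_ne_top hS hSW)).1 hle)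

theorem facetEquiv_apply (h : IsBuilding F W) (S : F.erase W) :
    (h.facetEquiv S).1 = faceOf F (indicatorOf S.1) := rfl

theorem facetOp_cls_apply (P : Polytope) : facetOp P.cls = P.facetSum := by
  have h : P.cls = MonoidAlgebra.single P.type 1 := rfl
  simp [facetOp, h]
  rfl

/-- This formula turns every later computation of `d` into bookkeeping with restrictions and
contractions. -/
theorem facetOp_cls (h : IsBuilding F W) : facetOp (simplexSum F).cls =
    ∑ S ∈ F.erase W, (simplexSum (restrictFam F S)).cls * (simplexSum (contractFam F S)).cls := by
  rw [facetOp_cls_apply, Polytope.facetSum, ← h.facetEquiv.sum_comp,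
    ← Finset.sum_coe_sort (F.erase W) fun S =>
      (simplexSum (restrictFam F S)).cls * (simplexSum (contractFam F S)).cls]
  refine Finset.sum_congr rfl fun S _ => ?_
  rw [facetEquiv_apply, cls_ofFace_indicatorOf]

end IsBuilding

end facets

/-! ### Simplicity and dimension of nestohedra. -/

section simple

variable {V : Type} [Fintype V] [DecidableEq V]

set_option linter.unusedSectionVars false

theorem sum_single_mem_minSet {w : V → ℝ} {F : Finset (Finset V)} {g : Finset V → V}
    (hg : ∀ S ∈ F.erase ∅, g S ∈ argmin w S) :
    ∑ S ∈ F.erase ∅, (Pi.single (g S) 1 : V → ℝ) ∈ minSet w (simplexSumSet F) := by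
  refine (sum_mem_minSet fun S hS => ?_).2 fun S hS => ?_
  · exact single_mem_simplexOn (argmin_subset _ _ (hg S hS))
  · exact (single_mem_minSet (argmin_subset _ _ (hg S hS))).2 (hg S hS)

/-- Only the vertex chosen in the summand `T` varies, so the face contains two points differing by
`e_i - e_j`. This gives uniqueness of minimisers at a vertex, and the directions spanning the affine
hull. -/
theorem exists_selection (w : V → ℝ) {F : Finset (Finset V)} {T : Finset V}
    (hT : T ∈ F) {i j : V} (hi : i ∈ argmin w T) (hj : j ∈ argmin w T) :
    ∃ p : V → ℝ, p + Pi.single i 1 ∈ minSet w (simplexSumSet F) ∧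
      p + Pi.single j 1 ∈ minSet w (simplexSumSet F) := by
  obtain ⟨g, hg, -, -⟩ := exists_mem_minSet w hT hi
  have hT' : T ∈ F.erase ∅ := by
    refine Finset.mem_erase.2 ⟨?_, hT⟩
    rintro rfl
    simpa using argmin_subset _ _ hi
  have key : ∀ k ∈ argmin w T, (∑ S ∈ (F.erase ∅).erase T, (Pi.single (g S) 1 : V → ℝ)) +
      Pi.single k 1 ∈ minSet w (simplexSumSet F) := by
    intro k hk
    have h := sum_single_mem_minSet (F := F) (w := w) (g := Function.update g T k) (by
      intro S hS
      by_cases e : S = T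
      · subst e; simpa using hk
      · simpa [e] using hg S hS)
    rw [← Finset.sum_erase_add _ _ hT'] at h
    have h' : ∑ S ∈ (F.erase ∅).erase T, (Pi.single (Function.update g T k S) 1 : V → ℝ) =
        ∑ S ∈ (F.erase ∅).erase T, Pi.single (g S) 1 :=
      Finset.sum_congr rfl fun S hS => by
        rw [Function.update_of_ne (Finset.ne_of_mem_erase hS)]
    rwa [h', Function.update_self] at h
  exact ⟨_, key i hi, key j hj⟩

/-- Extreme points of a Minkowski sum of simplices are exposed. -/
theorem exists_minSet_eq_singleton {F : Finset (Finset V)} {v : V → ℝ}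
    (hv : v ∈ (simplexSumSet F).extremePoints ℝ) :
    ∃ w, minSet w (simplexSumSet F) = {v} := by
  obtain ⟨s, hf, hne, hs⟩ : ∃ s : Set (V → ℝ), s.Finite ∧ s.Nonempty ∧
    simplexSumSet F = convexHull ℝ s := (simplexSum F).exists_hull
  rw [hs] at hv ⊢
  have hvs : v ∈ s := extremePoints_convexHull_subset hv
  have hc := ((convex_convexHull ℝ s).mem_extremePoints_iff_convex_sdiff.1 hv).2
  -- Removing an extreme point leaves a convex set, which contains the hull of the other generators.
  have hvn : v ∉ convexHull ℝ (s \ {v}) := fun h =>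
    (convexHull_min (Set.sdiff_subset_sdiff_left (subset_convexHull ℝ s)) hc h).2 rfl
  -- Strict separation from the other generators makes `v` the unique minimiser of `f` in `s`.
  obtain ⟨f, u, hfu, hu⟩ := geometric_hahn_banach_point_closed (convex_convexHull ℝ _)
    ((hf.subset Set.sdiff_subset).isCompact_convexHull (𝕜 := ℝ)).isClosed hvn
  obtain ⟨c, hc1, ⟨x, hx, hxc⟩, h⟩ := argmin_hull hf hne (f : (V → ℝ) →ₗ[ℝ] ℝ)
  have hlt : ∀ y ∈ s, y ≠ v → f v < f y := fun y hy hyv =>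
    hfu.trans (hu y (subset_convexHull ℝ _ ⟨hy, hyv⟩))
  have hcv : c ≤ f v := hc1 v (subset_convexHull ℝ _ hvs)
  have hxc : f x = c := hxc
  have hxv : x = v := by
    by_contra hxv
    exact absurd (hlt x hx hxv) (by linarith)
  have hset : {y ∈ s | (f : (V → ℝ) →ₗ[ℝ] ℝ) y = c} = {v} := by
    ext y
    constructor
    · rintro ⟨hy, hyc⟩
      have hyc : f y = c := hyc
      by_contra hyv
      exact absurd (hlt y hy hyv) (by linarith)
    · rintro rfl
      exact ⟨hvs, by rw [← hxc, hxv]; rfl⟩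
  refine ⟨fun i => f (Pi.single i 1), ?_⟩
  rw [minSet]
  have e : weightFun (fun i => f (Pi.single i 1)) = (f : (V → ℝ) →ₗ[ℝ] ℝ) :=
    (eq_weightFun (f : (V → ℝ) →ₗ[ℝ] ℝ)).symm
  rw [e, h, hset, convexHull_singleton]

/-- Sending `S` to its unique minimiser is a bijection onto `W`. If `S` and `S'` share the minimiser
`i`, then `i` also minimises `S ∪ S'`; as it lies in `S`, the condition on `S` forces `S' ⊆ S`, and
symmetrically. For surjectivity, the component of `i` has `i` as its minimiser. -/
theorem IsBuilding.card_filter_refines {F : Finset (Finset V)} {W : Finset V}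
    (h : IsBuilding F W) {w : V → ℝ}
    (hw : ∀ T ∈ F, ∀ i ∈ argmin w T, ∀ j ∈ argmin w T, i = j)
    [DecidablePred fun S => Refines F w (indicatorOf S)] :
    (F.filter fun S => Refines F w (indicatorOf S)).card = W.card := by
  have hne : ∀ S ∈ F.filter fun S => Refines F w (indicatorOf S), (argmin w S).Nonempty :=
    fun S hS => argmin_nonempty w (h.nonempty S (Finset.mem_filter.1 hS).1)
  refine Finset.card_bij (fun S hS => (hne S hS).choose) ?_ ?_ ?_
  · intro S hS
    exact h.subset S (Finset.mem_filter.1 hS).1 (argmin_subset _ _ (hne S hS).choose_spec)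
  · have key : ∀ S ∈ F, ∀ S' ∈ F, ∀ i ∈ argmin w S, i ∈ argmin w S' →
        Refines F w (indicatorOf S) → S' ⊆ S := by
      intro S hS S' hS' i hi hi' hr
      by_contra hn
      have h1 := refines_indicatorOf.1 hr (S ∪ S') (h.union_mem S hS S' hS'
        ⟨i, Finset.mem_inter.2 ⟨argmin_subset _ _ hi, argmin_subset _ _ hi'⟩⟩)
        fun hh => hn (Finset.subset_union_right.trans hh)
      have h2 : i ∈ argmin w (S ∪ S') := by
        rw [mem_argmin] at hi hi' ⊢
        refine ⟨Finset.mem_union_left _ hi.1, fun j hj => ?_⟩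
        rcases Finset.mem_union.1 hj with hj | hj
        · exact hi.2 j hj
        · exact hi'.2 j hj
      exact (Finset.mem_sdiff.1 (h1 h2)).2 (argmin_subset _ _ hi)
    intro S hS S' hS' he
    have h1 := (hne S hS).choose_spec
    have h2 := (hne S' hS').choose_spec
    have h1' := he ▸ h1
    have h2' := he ▸ h2
    rw [Finset.mem_filter] at hS hS'
    exact (key S' hS'.1 S hS.1 _ h2 h1' hS'.2).antisymm (key S hS.1 S' hS'.1 _ h1 h2' hS.2)
  · intro i hi
    obtain ⟨S, hS, hiS, hle, hmax⟩ := h.exists_component w hi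
    have hS' : S ∈ F.filter fun S => Refines F w (indicatorOf S) :=
      Finset.mem_filter.2 ⟨hS, IsBuilding.refines_component hle hmax⟩
    exact ⟨S, hS', hw S hS _ (hne S hS').choose_spec i (mem_argmin.2 ⟨hiS, hle⟩)⟩

theorem IsBuilding.ncard_facets {F : Finset (Finset V)} {W : Finset V} (h : IsBuilding F W)
    {v : V → ℝ} (hv : v ∈ (simplexSumSet F).extremePoints ℝ) :
    {G : (simplexSum F).Facet | v ∈ G.1.1}.ncard = W.card - 1 := by
  classical
  obtain ⟨w, hw⟩ := exists_minSet_eq_singleton hv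
  have hmem : ∀ S, v ∈ (faceOf F (indicatorOf S)).1 ↔ Refines F w (indicatorOf S) := by
    intro S
    rw [← minSet_subset_iff, hw]
    exact Set.singleton_subset_iff.symm
  have huniq : ∀ T ∈ F, ∀ i ∈ argmin w T, ∀ j ∈ argmin w T, i = j := by
    intro T hT i hi j hj
    obtain ⟨p, h1, h2⟩ := exists_selection w hT hi hj
    rw [hw] at h1 h2
    have h3 : (Pi.single i 1 : V → ℝ) = Pi.single j 1 :=
      add_left_cancel (Eq.trans h1 (Eq.symm h2))
    by_contra hij
    have := congrFun h3 i
    simp [hij] at this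
  have hset : {G : (simplexSum F).Facet | v ∈ G.1.1} =
      h.facetEquiv '' {S | Refines F w (indicatorOf S.1)} := by
    ext G
    obtain ⟨S, rfl⟩ := h.facetEquiv.surjective G
    rw [h.facetEquiv.injective.mem_set_image, Set.mem_ofPred_eq, IsBuilding.facetEquiv_apply, hmem]
    rfl
  -- `W` is counted by `card_filter_refines` but gives no facet, whence the `- 1`.
  have hW : Refines F w (indicatorOf W) :=
    refines_indicatorOf.2 fun T hT hn => absurd (h.subset T hT) hn
  have himg : Subtype.val '' {S : F.erase W | Refines F w (indicatorOf S.1)} =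
      (((F.filter fun S => Refines F w (indicatorOf S)).erase W : Finset (Finset V)) :
        Set (Finset V)) := by
    ext S
    simp only [Set.mem_image, Set.mem_ofPred_eq, Subtype.exists, Finset.mem_erase, exists_and_right,
      exists_eq_right, Finset.coe_erase, Finset.coe_filter, Set.mem_sdiff, Set.mem_singleton_iff]
    tauto
  rw [hset, Set.ncard_image_of_injective _ h.facetEquiv.injective,
    ← Set.ncard_image_of_injective _ Subtype.val_injective, himg, Set.ncard_coe_finset,
    Finset.card_erase_of_mem (Finset.mem_filter.2 ⟨h.self_mem, hW⟩), h.card_filter_refines huniq]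

/-- All simplices lie in the hyperplane of coordinate sum `1`, so the coordinate sum is constant on
the polytope. Conversely, the summand on the whole ground set supplies every direction `e_i - e_k`.
-/
theorem vectorSpan_simplexSumSet {F : Finset (Finset V)} (h : IsBuilding F Finset.univ) :
    vectorSpan ℝ (simplexSumSet F) = LinearMap.ker (weightFun (1 : V → ℝ)) := by
  have hsimp : ∀ T : Finset V, ∀ x ∈ simplexOn T, weightFun (1 : V → ℝ) x = 1 := by
    intro T x hx
    refine (convexHull_min ?_ (convex_hyperplane (weightFun (1 : V → ℝ)).isLinear 1) hx :
      x ∈ {y | weightFun (1 : V → ℝ) y = 1})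
    rintro _ ⟨i, -, rfl⟩
    simp
  have hconst : ∀ x ∈ simplexSumSet F, weightFun (1 : V → ℝ) x = (F.erase ∅).card := by
    intro x hx
    obtain ⟨g, hg, rfl⟩ := (Set.mem_finsetSum _ _ _).1 hx
    rw [map_sum, Finset.sum_congr rfl fun T hT => hsimp T _ (hg hT)]
    simp
  refine le_antisymm ?_ ?_
  · rw [vectorSpan_def, Submodule.span_le]
    rintro _ ⟨x, hx, y, hy, rfl⟩
    change weightFun (1 : V → ℝ) (x - y) = 0
    rw [map_sub, hconst x hx, hconst y hy, sub_self]
  · intro x hx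
    have hx : weightFun (1 : V → ℝ) x = 0 := hx
    have hx' : ∑ i, x i = 0 := by simpa [weightFun_apply] using hx
    obtain ⟨k, hk⟩ := h.nonempty _ h.self_mem
    have hmem : ∀ i, (Pi.single i 1 - Pi.single k 1 : V → ℝ) ∈ vectorSpan ℝ (simplexSumSet F) := by
      intro i
      -- For the zero weight every vertex is minimal, so `exists_selection` applies to any pair.
      have ha : ∀ i, i ∈ argmin (0 : V → ℝ) Finset.univ := fun i => mem_argmin.2 (by simp)
      obtain ⟨p, h1, h2⟩ := exists_selection (0 : V → ℝ) h.self_mem (ha i) (ha k)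
      have := vsub_mem_vectorSpan ℝ h1.1 h2.1
      simpa using this
    have hsum : x = ∑ i, x i • (Pi.single i 1 - Pi.single k 1 : V → ℝ) := by
      simp only [smul_sub, Finset.sum_sub_distrib]
      rw [← Finset.sum_smul, hx', zero_smul, sub_zero]
      ext j
      simp [Finset.sum_apply, Pi.single_apply]
    rw [hsum]
    exact Submodule.sum_mem _ fun i _ => Submodule.smul_mem _ _ (hmem i)

theorem dim_nestohedron (B : BuildingSet V) : (nestohedron B).dim = Fintype.card V - 1 := by
  rw [nestohedron_eq_simplexSum]
  have h := vectorSpan_simplexSumSet B.isBuilding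
  obtain ⟨k, -⟩ := B.nonempty_of_mem _ B.univ_mem
  have hr : LinearMap.range (weightFun (1 : V → ℝ)) = ⊤ := by
    refine LinearMap.range_eq_top.2 fun c => ⟨c • Pi.single k 1, ?_⟩
    rw [map_smul, weightFun_single]
    simp
  have hn := LinearMap.finrank_range_add_finrank_ker (weightFun (1 : V → ℝ))
  rw [hr, finrank_top, Module.finrank_self, Module.finrank_fintype_fun_eq_card, ← h] at hn
  have hd : (simplexSum B.sets).dim = Module.finrank ℝ (vectorSpan ℝ (simplexSumSet B.sets)) := rfl
  omega

theorem isSimple_nestohedron (B : BuildingSet V) : (nestohedron B).IsSimple := by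
  intro v hv
  rw [dim_nestohedron]
  have key : ∀ P : Polytope, P = simplexSum B.sets → ∀ v ∈ P.carrier.extremePoints ℝ,
      {G : P.Facet | v ∈ G.1.1}.ncard = Fintype.card V - 1 := by
    rintro _ rfl v hv
    exact B.isBuilding.ncard_facets hv
  exact key _ (nestohedron_eq_simplexSum B) v hv

/-- The family is moved to the ground type `W` along the inclusion, where it becomes a
`BuildingSet`; relabelling preserves the combinatorial type. -/
theorem isBuilding_isSimple {F : Finset (Finset V)} {W : Finset V} (h : IsBuilding F W) :
    ∃ P : Polytope, P.IsSimple ∧ (simplexSum F).cls = P.cls := by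
  let f : W ↪ V := Function.Embedding.subtype _
  let B : BuildingSet W :=
    { sets := Finset.univ.filter fun S => S.map f ∈ F
      nonempty_of_mem := fun S hS => by
        simpa using h.nonempty _ (Finset.mem_filter.1 hS).2
      singleton_mem := fun i => by
        simpa [f] using h.singleton_mem i i.2
      union_mem := fun S hS T hT hne => by
        have hS := (Finset.mem_filter.1 hS).2
        have hT := (Finset.mem_filter.1 hT).2
        refine Finset.mem_filter.2 ⟨Finset.mem_univ _, ?_⟩
        rw [Finset.map_union]
        refine h.union_mem _ hS _ hT ?_
        rw [← Finset.map_inter]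
        simpa using hne
      univ_mem := Finset.mem_filter.2 ⟨Finset.mem_univ _, by
        convert h.self_mem
        ext i
        simp [f]⟩ }
  refine ⟨nestohedron B, isSimple_nestohedron B, ?_⟩
  rw [nestohedron_eq_simplexSum, ← cls_simplexSum_map f]
  congr 2
  ext T
  rw [Finset.mem_image]
  constructor
  · intro hT
    have : (T.subtype (· ∈ W)).map f = T := by
      rw [Finset.subtype_map]
      exact Finset.filter_true_of_mem fun i hi => h.subset T hT hi
    exact ⟨T.subtype (· ∈ W), Finset.mem_filter.2 ⟨Finset.mem_univ _, this.symm ▸ hT⟩, this⟩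
  · rintro ⟨S, hS, rfl⟩
    exact (Finset.mem_filter.1 hS).2

end simple

/-! The facet operator is a derivation, and its exponential. -/

theorem isCoatom_prod_iff {A B : Type*} [PartialOrder A] [PartialOrder B] [OrderTop A] [OrderTop B]
    {a : A} {b : B} : IsCoatom (a, b) ↔ IsCoatom a ∧ b = ⊤ ∨ IsCoatom b ∧ a = ⊤ := by
  rw [← covBy_top_iff, ← covBy_top_iff, ← covBy_top_iff, show (⊤ : A × B) = (⊤, ⊤) from rfl,
    Prod.mk_covBy_mk_iff]

namespace Polytope

/-- The facets of a product. -/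
noncomputable def facetProdEquiv (P Q : Polytope) : P.Facet ⊕ Q.Facet ≃ (P.prod Q).Facet :=
  Equiv.ofBijective (Sum.elim
    (fun F => ⟨P.prodIso Q (F.1, ⊤), ((P.prodIso Q).isCoatom_iff _).2
      (isCoatom_prod_iff.2 (Or.inl ⟨F.2, rfl⟩))⟩)
    (fun G => ⟨P.prodIso Q (⊤, G.1), ((P.prodIso Q).isCoatom_iff _).2
      (isCoatom_prod_iff.2 (Or.inr ⟨G.2, rfl⟩))⟩)) (by
    constructor
    · rintro (F | F) (G | G) h
      · have h := (P.prodIso Q).injective (congrArg Subtype.val h)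
        exact congrArg Sum.inl (Subtype.ext (congrArg Prod.fst h))
      · have h := (P.prodIso Q).injective (congrArg Subtype.val h)
        exact absurd (congrArg Prod.fst h) F.2.1
      · have h := (P.prodIso Q).injective (congrArg Subtype.val h)
        exact absurd (congrArg Prod.snd h) F.2.1
      · have h := (P.prodIso Q).injective (congrArg Subtype.val h)
        exact congrArg Sum.inr (Subtype.ext (congrArg Prod.snd h))
    · rintro ⟨H, hH⟩
      obtain ⟨⟨F, G⟩, rfl⟩ := (P.prodIso Q).surjective H
      rcases isCoatom_prod_iff.1 (((P.prodIso Q).isCoatom_iff _).1 hH) with ⟨h, rfl⟩ | ⟨h, rfl⟩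
      · exact ⟨Sum.inl ⟨F, h⟩, rfl⟩
      · exact ⟨Sum.inr ⟨G, h⟩, rfl⟩)

theorem cls_prod (P Q : Polytope) : (P.prod Q).cls = P.cls * Q.cls := by
  rw [cls, cls, cls, ← map_mul]
  rfl

/-- The facets of `P × Q` are the products `F × Q` and `P × G` with `F` and `G` facets. This is the
Leibniz rule for `d`. -/
theorem facetSum_prod (P Q : Polytope) :
    (P.prod Q).facetSum = P.facetSum * Q.cls + P.cls * Q.facetSum := by
  have h1 : ∀ F : P.Face, ∀ G : Q.Face,
      ((P.prod Q).ofFace (P.prodIso Q (F, G))).cls = (P.ofFace F).cls * (Q.ofFace G).cls :=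
    fun F G => cls_prod (P.ofFace F) (Q.ofFace G)
  rw [facetSum, ← (facetProdEquiv P Q).sum_comp, Fintype.sum_sum_type, facetSum, facetSum,
    Finset.sum_mul, Finset.mul_sum]
  congr 1
  · exact Finset.sum_congr rfl fun F _ => h1 F.1 ⊤
  · exact Finset.sum_congr rfl fun G _ => h1 ⊤ G.1

end Polytope

theorem facetOp_mul (a b : PolytopeAlg) : facetOp (a * b) = a * facetOp b + b * facetOp a := by
  induction a using MonoidAlgebra.induction_on with
  | of m =>
    induction b using MonoidAlgebra.induction_on with
    | of n =>
      induction m using Quotient.inductionOn with | _ P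
      induction n using Quotient.inductionOn with | _ Q
      change facetOp (P.cls * Q.cls) = P.cls * facetOp Q.cls + Q.cls * facetOp P.cls
      rw [← Polytope.cls_prod, IsBuilding.facetOp_cls_apply, IsBuilding.facetOp_cls_apply,
        IsBuilding.facetOp_cls_apply, Polytope.facetSum_prod]
      ring
    | add a b ha hb => rw [mul_add, map_add, ha, hb, map_add]; ring
    | smul r a ha => rw [mul_smul_comm, map_smul, ha, map_smul]; simp [smul_add]
  | add a b ha hb => rw [add_mul, map_add, ha, hb, map_add]; ring
  | smul r a ha => rw [smul_mul_assoc, map_smul, ha, map_smul]; simp [smul_add]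

/-- The facet operator as a derivation. -/
noncomputable def facetDerivation : Derivation ℚ PolytopeAlg PolytopeAlg :=
  Derivation.mk' facetOp facetOp_mul

section exponential

variable {R : Type*} [CommRing R] [Algebra ℚ R] (D : Derivation ℚ R R)

/-- Lets the factor `n + 1` be cancelled when power series are compared through their derivatives.
-/
theorem isUnit_natCast_succ (n : ℕ) : IsUnit ((n : R) + 1) := by
  have : IsUnit (algebraMap ℚ R (n + 1)) :=
    (IsUnit.mk0 (n + 1 : ℚ) (by positivity)).map (algebraMap ℚ R)
  simpa using this

theorem derivative_mk_expCoeff (a : ℕ → R) :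
    PowerSeries.derivative R (PowerSeries.mk fun n => (1 / (n.factorial : ℚ)) • a n) =
      PowerSeries.mk fun n => (1 / (n.factorial : ℚ)) • a (n + 1) := by
  ext n
  rw [PowerSeries.coeff_derivative, PowerSeries.coeff_mk, PowerSeries.coeff_mk]
  have h : ((n : R) + 1) = algebraMap ℚ R (n + 1) := by simp
  rw [h, mul_comm, ← Algebra.smul_def, smul_smul]
  congr 1
  rw [Nat.factorial_succ]
  push_cast
  have := Nat.factorial_pos n
  field_simp

/-- The exponential series `∑ D^k a q^k / k!`. -/
noncomputable def expSeries (a : R) : PowerSeries R :=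
  PowerSeries.mk fun k => (1 / (k.factorial : ℚ)) • D^[k] a

theorem derivative_expSeries (a : R) :
    PowerSeries.derivative R (expSeries D a) = expSeries D (D a) :=
  derivative_mk_expCoeff fun k => D^[k] a

theorem coeff_expSeries (k : ℕ) (a : R) :
    PowerSeries.coeff k (expSeries D a) = (1 / (k.factorial : ℚ)) • D^[k] a :=
  PowerSeries.coeff_mk _ _

theorem iterate_add (k : ℕ) (a b : R) : D^[k] (a + b) = D^[k] a + D^[k] b := by
  induction k generalizing a b with
  | zero => rfl
  | succ k ih => rw [Function.iterate_succ_apply, map_add, ih]; rfl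

theorem expSeries_add (a b : R) : expSeries D (a + b) = expSeries D a + expSeries D b := by
  ext k
  rw [map_add, coeff_expSeries, coeff_expSeries, coeff_expSeries, iterate_add, smul_add]

/-- Coefficient `k + 1` is determined by coefficient `k` of the derivative. By the Leibniz rule on
both sides the derivatives are sums of two terms of the same kind, to which the induction applies.
-/
theorem expSeries_mul (a b : R) : expSeries D (a * b) = expSeries D a * expSeries D b := by
  ext k
  induction k generalizing a b with
  | zero => simp [PowerSeries.coeff_mul, coeff_expSeries]
  | succ k ih =>
    refine (isUnit_natCast_succ (R := R) k).mul_left_injective ?_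
    change _ * ((k : R) + 1) = _ * ((k : R) + 1)
    rw [← PowerSeries.coeff_derivative, ← PowerSeries.coeff_derivative, derivative_expSeries,
      Derivation.leibniz, Derivation.leibniz, expSeries_add, map_add, smul_eq_mul, smul_eq_mul,
      smul_eq_mul, smul_eq_mul, ih, ih, derivative_expSeries, derivative_expSeries, map_add]

/-- The exponential of a derivation, as a ring homomorphism to formal power series. -/
noncomputable def expHom : R →+* PowerSeries R where
  toFun := expSeries D
  map_one' := by
    ext k
    rw [coeff_expSeries, PowerSeries.coeff_one]
    cases k with
    | zero => simp
    | succ k =>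
      have : D^[k] (0 : R) = 0 := Function.iterate_fixed (map_zero D) k
      simp [Function.iterate_succ_apply, this]
  map_mul' := expSeries_mul D
  map_zero' := by
    ext k
    have : D^[k] (0 : R) = 0 := Function.iterate_fixed (map_zero D) k
    rw [coeff_expSeries, this]
    simp
  map_add' := expSeries_add D

theorem expHom_apply (a : R) : expHom D a = expSeries D a := rfl

end exponential

/-! ### Iterated facets: they stay in the simple ring and eventually vanish. -/

section families

variable {V : Type} [Fintype V] [DecidableEq V]

/-- The classes of the polytopes of building sets on subsets of `V`. -/
def buildingClasses (V : Type) [Fintype V] [DecidableEq V] : Set PolytopeAlg :=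
  {a | ∃ (F : Finset (Finset V)) (W : Finset V), IsBuilding F W ∧ a = (simplexSum F).cls}

/-- On a generator, `d` gives products of restrictions and contractions, which are generators over
the same `V`; the Leibniz rule carries this to the whole ring. -/
theorem facetOp_mem_closure {a : PolytopeAlg} (ha : a ∈ Subring.closure (buildingClasses V)) :
    facetOp a ∈ Subring.closure (buildingClasses V) := by
  induction ha using Subring.closure_induction with
  | mem a ha =>
    obtain ⟨F, W, h, rfl⟩ := ha
    rw [h.facetOp_cls]
    refine Subring.sum_mem _ fun S hS => Subring.mul_mem _ ?_ ?_ <;> apply Subring.subset_closure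
    · exact ⟨_, _, h.restrict (Finset.mem_of_mem_erase hS), rfl⟩
    · exact ⟨_, _, h.contract (Finset.mem_of_mem_erase hS) (Finset.ne_of_mem_erase hS), rfl⟩
  | zero => rw [map_zero]; exact Subring.zero_mem _
  | one =>
    have : facetOp 1 = 0 := facetDerivation.map_one_eq_zero
    rw [this]
    exact Subring.zero_mem _
  | add a b _ _ ha hb => rw [map_add]; exact Subring.add_mem _ ha hb
  | neg a _ ha => rw [map_neg]; exact Subring.neg_mem _ ha
  | mul a b ha' hb' ha hb =>
    rw [facetOp_mul]
    exact Subring.add_mem _ (Subring.mul_mem _ ha' hb) (Subring.mul_mem _ hb' ha)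

theorem closure_buildingClasses_le : Subring.closure (buildingClasses V) ≤ simplePolytopeRing := by
  refine (Subring.closure_le).2 ?_
  rintro _ ⟨F, W, h, rfl⟩
  obtain ⟨P, hP, he⟩ := isBuilding_isSimple h
  exact Subring.subset_closure ⟨P, hP, he⟩

theorem iterate_facetOp_mem {F : Finset (Finset V)} {W : Finset V} (h : IsBuilding F W) (k : ℕ) :
    facetOp^[k] (simplexSum F).cls ∈ simplePolytopeRing := by
  refine closure_buildingClasses_le (V := V) ?_
  induction k with
  | zero => exact Subring.subset_closure ⟨F, W, h, rfl⟩
  | succ k ih => rw [Function.iterate_succ_apply']; exact facetOp_mem_closure ih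

/-- The exponential has degree less than `|W|` in `q`. Its derivative is a sum of products of the
exponentials for `S` and `W \ S`. As these sets have `|W| ≤ k + 1` elements together, in each term
of total degree `k` one factor has reached the size of its ground set and vanishes. -/
theorem coeff_expHom_eq_zero {F : Finset (Finset V)} {W : Finset V} (h : IsBuilding F W) {k : ℕ}
    (hk : W.card ≤ k) : PowerSeries.coeff k (expHom facetDerivation (simplexSum F).cls) = 0 := by
  induction k using Nat.strong_induction_on generalizing F W with | _ k ih
  cases k with
  | zero =>
    have := (h.nonempty W h.self_mem).card_pos
    omega
  | succ k =>
    refine (isUnit_natCast_succ (R := PolytopeAlg) k).mul_left_injective ?_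
    change _ * ((k : PolytopeAlg) + 1) = 0 * ((k : PolytopeAlg) + 1)
    have hd : facetDerivation (simplexSum F).cls = facetOp (simplexSum F).cls := rfl
    rw [← PowerSeries.coeff_derivative, expHom_apply, derivative_expSeries, ← expHom_apply, hd,
      h.facetOp_cls, map_sum, map_sum, zero_mul]
    refine Finset.sum_eq_zero fun S hS => ?_
    have hSF := Finset.mem_of_mem_erase hS
    have hSW := Finset.ne_of_mem_erase hS
    rw [map_mul, PowerSeries.coeff_mul]
    refine Finset.sum_eq_zero fun p hp => ?_
    have hp := Finset.HasAntidiagonal.mem_antidiagonal.1 hp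
    have hcard := Finset.card_sdiff_add_card_eq_card (h.subset S hSF)
    by_cases hi : S.card ≤ p.1
    · rw [ih p.1 (by omega) (h.restrict hSF) hi, zero_mul]
    · rw [ih p.2 (by omega) (h.contract hSF hSW) (by omega), mul_zero]

theorem iterate_facetOp_eq_zero {F : Finset (Finset V)} {W : Finset V} (h : IsBuilding F W) {k : ℕ}
    (hk : W.card ≤ k) : facetOp^[k] (simplexSum F).cls = 0 := by
  have h1 := coeff_expHom_eq_zero h hk
  rw [expHom_apply, coeff_expSeries] at h1
  refine (smul_eq_zero.1 h1).resolve_left ?_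
  have := Nat.factorial_pos k
  positivity

end families

/-! ### The four families on an arbitrary ground set with distinguished vertices. -/

section families

variable {V : Type} [Fintype V] [DecidableEq V]

set_option linter.unusedSectionVars false

/-- All nonempty subsets of `W`. -/
def completeFam (W : Finset V) : Finset (Finset V) := W.powerset.filter fun T => T.Nonempty

/-- The graphical building set of the star on `W` with centre `c`. -/
def starFam (c : V) (W : Finset V) : Finset (Finset V) :=
  W.powerset.filter fun T => T.card = 1 ∨ c ∈ T

/-- The building set on `W` of the singletons, the sets which avoid `b` and the sets which contain
both `a` and `b`. -/
def gammaFam (a b : V) (W : Finset V) : Finset (Finset V) :=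
  W.powerset.filter fun T => T.card = 1 ∨ (T.Nonempty ∧ b ∉ T) ∨ (a ∈ T ∧ b ∈ T)

/-- The building set on `W` of the singletons, the sets which contain `a` and `c`, and the sets
which contain `a` and avoid `b` and `c`. -/
def masFam (a c b : V) (W : Finset V) : Finset (Finset V) :=
  W.powerset.filter fun T => T.card = 1 ∨ (a ∈ T ∧ c ∈ T) ∨ (a ∈ T ∧ c ∉ T ∧ b ∉ T)

theorem mem_completeFam {W T : Finset V} : T ∈ completeFam W ↔ T ⊆ W ∧ T.Nonempty := by
  simp [completeFam]

theorem mem_starFam {c : V} {W T : Finset V} :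
    T ∈ starFam c W ↔ T ⊆ W ∧ (T.card = 1 ∨ c ∈ T) := by
  simp [starFam]

theorem mem_gammaFam {a b : V} {W T : Finset V} :
    T ∈ gammaFam a b W ↔ T ⊆ W ∧ (T.card = 1 ∨ (T.Nonempty ∧ b ∉ T) ∨ (a ∈ T ∧ b ∈ T)) := by
  simp [gammaFam]

theorem mem_masFam {a c b : V} {W T : Finset V} : T ∈ masFam a c b W ↔
    T ⊆ W ∧ (T.card = 1 ∨ (a ∈ T ∧ c ∈ T) ∨ (a ∈ T ∧ c ∉ T ∧ b ∉ T)) := by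
  simp [masFam]

/-- Numbers the elements of `W` with the labels in `s` sent to prescribed vertices; the values of
`f` off `s` are irrelevant. -/
theorem exists_labelling {n : ℕ} {W : Finset V} (hW : W.card = n + 1) (s : Finset (Fin (n + 1)))
    (f : Fin (n + 1) → V) (hf : ∀ i ∈ s, f i ∈ W) (hinj : Set.InjOn f s) :
    ∃ e : Fin (n + 1) ↪ V, Finset.univ.map e = W ∧ ∀ i ∈ s, e i = f i := by
  obtain ⟨g, hg⟩ := Finset.exists_equiv_extend_of_card_eq (t := W) (s := s) (f := f)
    (by simp [hW]) (Finset.image_subset_iff.2 hf) hinj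
  refine ⟨g.toEmbedding.trans (Function.Embedding.subtype _), ?_, hg⟩
  ext i
  rw [Finset.mem_map]
  constructor
  · rintro ⟨j, -, rfl⟩
    exact (g j).2
  · intro hi
    exact ⟨g.symm ⟨i, hi⟩, Finset.mem_univ _, by simp⟩

theorem cls_eq_nestohedron {V₀ : Type} [Fintype V₀] [DecidableEq V₀] (B : BuildingSet V₀)
    {F : Finset (Finset V)} {W : Finset V} (hF : ∀ T ∈ F, T ⊆ W) (e : V₀ ↪ V)
    (he : Finset.univ.map e = W) (h : ∀ S, S.map e ∈ F ↔ S ∈ B.sets) :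
    (simplexSum F).cls = (nestohedron B).cls := by
  rw [nestohedron_eq_simplexSum, ← cls_simplexSum_map e]
  congr 2
  ext T
  rw [Finset.mem_image]
  constructor
  · intro hT
    have hTW := hF T hT
    rw [← he, Finset.subset_map_iff] at hTW
    obtain ⟨S, -, rfl⟩ := hTW
    exact ⟨S, (h S).1 hT, rfl⟩
  · rintro ⟨S, hS, rfl⟩
    exact (h S).2 hS

theorem mem_graphBuildingSet {G : SimpleGraph V} {hG : G.Connected} {S : Finset V} :
    S ∈ (graphBuildingSet G hG).sets ↔ (G.induce (S : Set V)).Connected := by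
  simp [graphBuildingSet]

theorem mem_graphBuildingSet_top {hG : (⊤ : SimpleGraph V).Connected} {S : Finset V} :
    S ∈ (graphBuildingSet (⊤ : SimpleGraph V) hG).sets ↔ S.Nonempty := by
  rw [mem_graphBuildingSet]
  constructor
  · intro h
    obtain ⟨⟨x, hx⟩⟩ := h.nonempty
    exact ⟨x, hx⟩
  · rintro ⟨x, hx⟩
    have : Nonempty (S : Set V) := ⟨⟨x, hx⟩⟩
    have h : (⊤ : SimpleGraph V).induce (S : Set V) = ⊤ := by
      ext u v
      rw [SimpleGraph.comap_adj, SimpleGraph.top_adj, SimpleGraph.top_adj]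
      exact Subtype.val_injective.ne_iff
    rw [h]
    exact SimpleGraph.connected_top

/-- Without the centre there are no edges, so only single vertices are connected; with it, the
centre is adjacent to all the rest. -/
theorem mem_graphBuildingSet_star {c : V} {hG : (SimpleGraph.starGraph c).Connected}
    {S : Finset V} :
    S ∈ (graphBuildingSet (SimpleGraph.starGraph c) hG).sets ↔ S.card = 1 ∨ c ∈ S := by
  rw [mem_graphBuildingSet]
  constructor
  · intro h
    by_contra! hc
    obtain ⟨⟨x, hx⟩⟩ := h.nonempty
    have h1 : 1 < S.card := by
      have : 0 < S.card := Finset.card_pos.2 ⟨x, hx⟩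
      omega
    have : Nontrivial (S : Set V) := by
      obtain ⟨u, hu, v, hv, huv⟩ := Finset.one_lt_card.1 h1
      exact ⟨⟨u, hu⟩, ⟨v, hv⟩, fun e => huv (congrArg Subtype.val e)⟩
    obtain ⟨⟨y, hy⟩, hxy⟩ := h.preconnected.exists_adj_of_nontrivial ⟨x, hx⟩
    have hxy : (SimpleGraph.starGraph c).Adj x y := hxy
    rcases (SimpleGraph.starGraph_adj.1 hxy).2 with rfl | rfl
    · exact hc.2 hx
    · exact hc.2 hy
  · rintro (h | h)
    · obtain ⟨a, rfl⟩ := Finset.card_eq_one.1 h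
      rw [← mem_graphBuildingSet (hG := hG)]
      exact (graphBuildingSet _ hG).singleton_mem a
    · refine SimpleGraph.Connected.of_isUniversal (v := (⟨c, h⟩ : (S : Set V))) ?_
      intro v hv
      refine SimpleGraph.starGraph_center_adj fun e => hv (Subtype.ext e)

theorem mem_gammaBuildingSet {n : ℕ} {S : Finset (Fin (n + 1 + 1))} :
    S ∈ (gammaBuildingSet (n + 1)).sets ↔
      S.card = 1 ∨ (S.Nonempty ∧ Fin.last (n + 1) ∉ S) ∨ (0 ∈ S ∧ Fin.last (n + 1) ∈ S) := by
  have h1 : S = Finset.univ → 0 ∈ S ∧ Fin.last (n + 1) ∈ S := by rintro rfl; simp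
  have h2 := Finset.card_pos (s := S)
  simp only [gammaBuildingSet, Finset.mem_union, Finset.mem_filter, Finset.mem_univ, true_and,
    Finset.mem_singleton]
  by_cases hS : S.Nonempty
  · have := h2.2 hS
    have h3 : S.card = 1 ∨ 2 ≤ S.card := by omega
    tauto
  · rw [Finset.not_nonempty_iff_eq_empty] at hS
    subst hS
    simpa using (Finset.univ_nonempty (α := Fin (n + 1 + 1))).ne_empty.symm

theorem mem_masBuildingSet {m : ℕ} {S : Finset (Fin (m + 2 + 1))} :
    S ∈ (masBuildingSet m).sets ↔
      S.card = 1 ∨ (0 ∈ S ∧ 1 ∈ S) ∨ (0 ∈ S ∧ 1 ∉ S ∧ Fin.last (m + 2) ∉ S) := by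
  have h2 : 0 ∈ S → S.card = 1 ∨ 2 ≤ S.card := fun h => by
    have := Finset.card_pos.2 ⟨0, h⟩
    omega
  simp only [masBuildingSet, Finset.mem_union, Finset.mem_filter, Finset.mem_univ, true_and]
  tauto

theorem cls_completeFam {n : ℕ} {W : Finset V} (hW : W.card = n + 1) :
    (simplexSum (completeFam W)).cls = (permutohedron n).cls := by
  have : Nonempty V := (Finset.card_pos.1 (by omega : 0 < W.card)).to_subtype.map Subtype.val
  obtain ⟨e, he, -⟩ := exists_labelling hW ∅ (fun _ => Classical.arbitrary V) (by simp) (by simp)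
  refine cls_eq_nestohedron _ (fun T hT => (mem_completeFam.1 hT).1) e he fun S => ?_
  rw [mem_completeFam, mem_graphBuildingSet_top, ← he]
  simp

theorem cls_starFam {n : ℕ} {c : V} {W : Finset V} (hW : W.card = n + 1) (hc : c ∈ W) :
    (simplexSum (starFam c W)).cls = (stellahedron n).cls := by
  obtain ⟨e, he, h⟩ := exists_labelling hW {0} (fun _ => c) (by simp [hc]) (by simp)
  have h0 : e 0 = c := h 0 (by simp)
  subst h0
  refine cls_eq_nestohedron _ (fun T hT => (mem_starFam.1 hT).1) e he fun S => ?_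
  rw [mem_starFam, mem_graphBuildingSet_star, ← he]
  simp

theorem cls_gammaFam {n : ℕ} {a b : V} {W : Finset V} (hW : W.card = n + 2) (ha : a ∈ W)
    (hb : b ∈ W) (hab : a ≠ b) :
    (simplexSum (gammaFam a b W)).cls = (nestohedron (gammaBuildingSet (n + 1))).cls := by
  have hl : Fin.last (n + 1) ≠ 0 := Fin.last_pos.ne'
  obtain ⟨e, he, h⟩ := exists_labelling hW {0, Fin.last (n + 1)}
    (fun i => if i = 0 then a else b) (by simp [ha, hb, hl]) (by
      intro i hi j hj hij
      simp only [Finset.coe_insert, Finset.coe_singleton, Set.mem_insert_iff,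
        Set.mem_singleton_iff] at hi hj
      rcases hi with rfl | rfl <;> rcases hj with rfl | rfl <;> simp [hl] at hij ⊢
      · exact absurd hij hab
      · exact absurd hij hab.symm)
  have h0 : e 0 = a := by simpa using h 0 (by simp)
  have h1 : e (Fin.last (n + 1)) = b := by simpa [hl] using h (Fin.last (n + 1)) (by simp)
  subst h0 h1
  refine cls_eq_nestohedron _ (fun T hT => (mem_gammaFam.1 hT).1) e he fun S => ?_
  rw [mem_gammaFam, mem_gammaBuildingSet, ← he]
  simp

theorem cls_masFam {m : ℕ} {a c b : V} {W : Finset V} (hW : W.card = m + 3) (ha : a ∈ W)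
    (hc : c ∈ W) (hb : b ∈ W) (hac : a ≠ c) (hab : a ≠ b) (hcb : c ≠ b) :
    (simplexSum (masFam a c b W)).cls = (masPolytope (m + 2)).cls := by
  have hl : Fin.last (m + 2) ≠ 0 := Fin.last_pos.ne'
  have hl1 : Fin.last (m + 2) ≠ 1 := by
    intro h
    have := congrArg Fin.val h
    simp at this
  obtain ⟨e, he, h⟩ := exists_labelling hW {0, 1, Fin.last (m + 2)}
    (fun i => if i = 0 then a else if i = 1 then c else b) (by simp [ha, hb, hc, hl, hl1]) (by
      intro i hi j hj hij
      simp only [Finset.coe_insert, Finset.coe_singleton, Set.mem_insert_iff,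
        Set.mem_singleton_iff] at hi hj
      rcases hi with rfl | rfl | rfl <;> rcases hj with rfl | rfl | rfl <;>
        simp [hl, hl1, hac, hab, hcb, hac.symm, hab.symm, hcb.symm] at hij ⊢)
  have h0 : e 0 = a := by simpa using h 0 (by simp)
  have h1 : e 1 = c := by simpa using h 1 (by simp)
  have h2 : e (Fin.last (m + 2)) = b := by
    simpa [hl, hl1] using h (Fin.last (m + 2)) (by simp)
  subst h0 h1 h2
  refine cls_eq_nestohedron _ (fun T hT => (mem_masFam.1 hT).1) e he fun S => ?_
  rw [mem_masFam, mem_masBuildingSet, ← he]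
  simp

end families

/-! ### Restrictions and contractions of the families `Γ` and `Mas`. -/

section facetFormulas

variable {V : Type} [Fintype V] [DecidableEq V]

set_option linter.unusedSectionVars false

/-- A member `U` meeting `S` may be replaced by `U ∪ S`, which is again a member with the same
trace. Membership in the contraction is thus decided by `T` and `T ∪ S` alone. -/
theorem IsBuilding.mem_contractFam {F : Finset (Finset V)} {W : Finset V} (h : IsBuilding F W)
    {S T : Finset V} (hS : S ∈ F) :
    T ∈ contractFam F S ↔ T.Nonempty ∧ Disjoint T S ∧ (T ∈ F ∨ T ∪ S ∈ F) := by
  rw [contractFam, Finset.mem_image]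
  constructor
  · rintro ⟨U, hU, rfl⟩
    obtain ⟨hU, hUS⟩ := Finset.mem_filter.1 hU
    refine ⟨Finset.sdiff_nonempty.2 hUS, Finset.sdiff_disjoint, ?_⟩
    by_cases hne : (U ∩ S).Nonempty
    · right
      rw [Finset.sdiff_union_self_eq_union]
      exact h.union_mem U hU S hS hne
    · left
      rw [Finset.not_nonempty_iff_eq_empty, ← Finset.disjoint_iff_inter_eq_empty] at hne
      rwa [Finset.sdiff_eq_self_of_disjoint hne]
  · rintro ⟨⟨i, hi⟩, hd, hT | hT⟩
    · exact ⟨T, Finset.mem_filter.2 ⟨hT, fun hs => Finset.disjoint_left.1 hd hi (hs hi)⟩,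
        Finset.sdiff_eq_self_of_disjoint hd⟩
    · refine ⟨T ∪ S, Finset.mem_filter.2 ⟨hT, fun hs => Finset.disjoint_left.1 hd hi
        (hs (Finset.mem_union_left _ hi))⟩, ?_⟩
      rw [Finset.union_sdiff_right, Finset.sdiff_eq_self_of_disjoint hd]

theorem card_union_ne_one {S T : Finset V} (hS : S.Nonempty) (hT : T.Nonempty)
    (hd : Disjoint T S) : (T ∪ S).card ≠ 1 := by
  rw [Finset.card_union_of_disjoint hd]
  have := hS.card_pos
  have := hT.card_pos
  omega

theorem subset_sdiff_iff_of_building {S T W : Finset V} (hS : S ⊆ W) :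
    T ⊆ W \ S ↔ Disjoint T S ∧ T ∪ S ⊆ W := by
  rw [Finset.subset_sdiff, Finset.union_subset_iff]
  tauto

section gamma

variable {a b : V} {W : Finset V}

theorem restrict_gammaFam_of_notMem {S : Finset V} (hS : S ⊆ W) (hb : b ∉ S) :
    restrictFam (gammaFam a b W) S = completeFam S := by
  ext T
  rw [restrictFam, Finset.mem_filter, mem_gammaFam, mem_completeFam]
  have h1 : T.card = 1 → T.Nonempty := fun h => Finset.card_pos.1 (by omega)
  have h2 : T ⊆ S → T ⊆ W := fun h => h.trans hS
  have h3 : T ⊆ S → b ∉ T := fun h hh => hb (h hh)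
  have h4 : b ∈ T → T.Nonempty := fun h => ⟨b, h⟩
  tauto

theorem restrict_gammaFam {S : Finset V} (hS : S ⊆ W) :
    restrictFam (gammaFam a b W) S = gammaFam a b S := by
  ext T
  rw [restrictFam, Finset.mem_filter, mem_gammaFam, mem_gammaFam]
  have h2 : T ⊆ S → T ⊆ W := fun h => h.trans hS
  tauto

theorem restrictFam_singleton (h : IsBuilding (gammaFam a b W) W) {i : V} (hi : i ∈ W) :
    restrictFam (gammaFam a b W) {i} = completeFam {i} := by
  ext T
  rw [restrictFam, Finset.mem_filter, mem_completeFam]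
  constructor
  · rintro ⟨h1, h2⟩
    exact ⟨h2, h.nonempty T h1⟩
  · rintro ⟨h1, h2⟩
    rw [Finset.Nonempty.subset_singleton_iff h2] at h1
    subst h1
    exact ⟨h.singleton_mem i hi, subset_rfl⟩

/-- A nonempty `T` avoiding `b` is itself a member, and this covers the case `b ∈ S`. If `a ∈ S` and
`b ∈ T`, then `T ∪ S` contains both. -/
theorem contract_gammaFam_complete (h : IsBuilding (gammaFam a b W) W) {S : Finset V}
    (hS : S ∈ gammaFam a b W) (hc : a ∈ S ∨ b ∈ S) :
    contractFam (gammaFam a b W) S = completeFam (W \ S) := by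
  ext T
  have hSW := h.subset S hS
  rw [h.mem_contractFam hS, mem_completeFam, subset_sdiff_iff_of_building hSW, mem_gammaFam,
    mem_gammaFam]
  have h1 : T ∪ S ⊆ W ↔ T ⊆ W := by rw [Finset.union_subset_iff]; tauto
  simp only [Finset.mem_union, h1]
  have h2 : (T ∪ S).Nonempty ↔ T.Nonempty ∨ S.Nonempty := Finset.union_nonempty
  have h3 : T.card = 1 → T.Nonempty := fun h => Finset.card_pos.1 (by omega)
  have h4 : Disjoint T S → b ∈ T → b ∉ S := fun h h' => Finset.disjoint_left.1 h h'
  grind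

/-- Adjoining `S` does not affect which of `a` and `b` a set contains. -/
theorem contract_gammaFam (h : IsBuilding (gammaFam a b W) W) {S : Finset V}
    (hS : S ∈ gammaFam a b W) (ha : a ∉ S) (hb : b ∉ S) :
    contractFam (gammaFam a b W) S = gammaFam a b (W \ S) := by
  ext T
  have hSW := h.subset S hS
  rw [h.mem_contractFam hS, mem_gammaFam (W := W \ S), subset_sdiff_iff_of_building hSW,
    mem_gammaFam, mem_gammaFam]
  have h1 : T ∪ S ⊆ W ↔ T ⊆ W := by rw [Finset.union_subset_iff]; tauto
  simp only [Finset.mem_union, h1]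
  have h2 : (T ∪ S).Nonempty ↔ T.Nonempty ∨ S.Nonempty := Finset.union_nonempty
  have h3 : T.card = 1 → T.Nonempty := fun h => Finset.card_pos.1 (by omega)
  have h4 : a ∈ T → T.Nonempty := fun h => ⟨a, h⟩
  have h5 : T.Nonempty → Disjoint T S → (T ∪ S).card ≠ 1 := card_union_ne_one (h.nonempty S hS)
  grind

end gamma

section mas

variable {a b c : V} {W : Finset V}

theorem restrict_masFam {S : Finset V} (hS : S ⊆ W) :
    restrictFam (masFam a c b W) S = masFam a c b S := by
  ext T
  rw [restrictFam, Finset.mem_filter, mem_masFam, mem_masFam]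
  have h2 : T ⊆ S → T ⊆ W := fun h => h.trans hS
  grind

theorem masFam_eq_starFam {S : Finset V} (hb : b ∉ S) : masFam a c b S = starFam a S := by
  ext T
  rw [mem_masFam, mem_starFam]
  have h2 : T ⊆ S → b ∉ T := fun h h' => hb (h h')
  grind

theorem masFam_singleton {i : V} : masFam a c b {i} = completeFam {i} := by
  ext T
  rw [mem_masFam, mem_completeFam]
  refine and_congr_right fun h => ⟨fun h' => ?_, fun h' => ?_⟩
  · rcases h' with h' | h' | h'
    · exact Finset.card_pos.1 (by omega)
    · exact ⟨a, h'.1⟩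
    · exact ⟨a, h'.1⟩
  · rw [Finset.Nonempty.subset_singleton_iff h'] at h
    simp [h]

theorem contract_masFam_complete (h : IsBuilding (masFam a c b W) W) {S : Finset V}
    (hS : S ∈ masFam a c b W) (ha : a ∈ S) (hc : c ∈ S) :
    contractFam (masFam a c b W) S = completeFam (W \ S) := by
  ext T
  have hSW := h.subset S hS
  rw [h.mem_contractFam hS, mem_completeFam, subset_sdiff_iff_of_building hSW, mem_masFam,
    mem_masFam]
  have h1 : T ∪ S ⊆ W ↔ T ⊆ W := by rw [Finset.union_subset_iff]; tauto
  simp only [Finset.mem_union, h1]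
  grind

/-- With `a` supplied by `S`, the set `T ∪ S` is a member exactly when `c ∈ T` or `b ∉ T`, and `{b}`
survives as a singleton. This is the `Γ` pattern with `c` as first and `b` as last vertex. -/
theorem contract_masFam_gamma (h : IsBuilding (masFam a c b W) W) {S : Finset V}
    (hS : S ∈ masFam a c b W) (ha : a ∈ S) (hc : c ∉ S) (hb : b ∉ S) :
    contractFam (masFam a c b W) S = gammaFam c b (W \ S) := by
  ext T
  have hSW := h.subset S hS
  rw [h.mem_contractFam hS, mem_gammaFam (W := W \ S), subset_sdiff_iff_of_building hSW,
    mem_masFam, mem_masFam]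
  have h1 : T ∪ S ⊆ W ↔ T ⊆ W := by rw [Finset.union_subset_iff]; tauto
  simp only [Finset.mem_union, h1]
  have h3 : T.card = 1 → T.Nonempty := fun h => Finset.card_pos.1 (by omega)
  have h4 : c ∈ T → T.Nonempty := fun h => ⟨c, h⟩
  have h5 : T.Nonempty → Disjoint T S → (T ∪ S).card ≠ 1 := card_union_ne_one ⟨a, ha⟩
  have h6 : Disjoint T S → a ∈ T → a ∉ S := fun h h' => Finset.disjoint_left.1 h h'
  grind

/-- Here `S` is `{c}` or `{b}`. If `S = {c}`, then `T ∪ S` is a member as soon as `a ∈ T`. If `S =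
{b}`, then `T` avoids `b` and is itself a member as soon as `a ∈ T`. -/
theorem contract_masFam_star (h : IsBuilding (masFam a c b W) W) {S : Finset V}
    (hS : S ∈ masFam a c b W) (ha : a ∉ S) (hbc : (c ∈ S ∧ b ∉ S) ∨ (b ∈ S ∧ c ∉ S)) :
    contractFam (masFam a c b W) S = starFam a (W \ S) := by
  ext T
  have hSW := h.subset S hS
  rw [h.mem_contractFam hS, mem_starFam, subset_sdiff_iff_of_building hSW,
    mem_masFam, mem_masFam]
  have h1 : T ∪ S ⊆ W ↔ T ⊆ W := by rw [Finset.union_subset_iff]; tauto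
  simp only [Finset.mem_union, h1]
  have h3 : T.card = 1 → T.Nonempty := fun h => Finset.card_pos.1 (by omega)
  have h4 : a ∈ T → T.Nonempty := fun h => ⟨a, h⟩
  have h5 : T.Nonempty → Disjoint T S → (T ∪ S).card ≠ 1 := card_union_ne_one (h.nonempty S hS)
  have h6 : Disjoint T S → c ∈ S → c ∉ T := fun h hS hT => Finset.disjoint_left.1 h hT hS
  have h7 : Disjoint T S → b ∈ S → b ∉ T := fun h hS hT => Finset.disjoint_left.1 h hT hS
  grind

theorem contract_masFam (h : IsBuilding (masFam a c b W) W) {S : Finset V}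
    (hS : S ∈ masFam a c b W) (ha : a ∉ S) (hc : c ∉ S) (hb : b ∉ S) :
    contractFam (masFam a c b W) S = masFam a c b (W \ S) := by
  ext T
  have hSW := h.subset S hS
  rw [h.mem_contractFam hS, mem_masFam (W := W \ S), subset_sdiff_iff_of_building hSW,
    mem_masFam, mem_masFam]
  have h1 : T ∪ S ⊆ W ↔ T ⊆ W := by rw [Finset.union_subset_iff]; tauto
  simp only [Finset.mem_union, h1]
  have h3 : T.card = 1 → T.Nonempty := fun h => Finset.card_pos.1 (by omega)
  have h4 : a ∈ T → T.Nonempty := fun h => ⟨a, h⟩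
  have h5 : T.Nonempty → Disjoint T S → (T ∪ S).card ≠ 1 := card_union_ne_one (h.nonempty S hS)
  grind

end mas

end facetFormulas

/-! ### Facet sums of `Γ` and `Mas` as sums over subsets of the ordinary vertices. -/

section sequences

/-- The classes of the permutohedra. -/
noncomputable def peSeq (k : ℕ) : PolytopeAlg := (permutohedron k).cls

/-- The classes of the permutohedra, indexed by the size of the ground set. -/
noncomputable def peCardSeq : ℕ → PolytopeAlg
  | 0 => 0
  | k + 1 => peSeq k

/-- The classes of the stellahedra. -/
noncomputable def stSeq (k : ℕ) : PolytopeAlg := (stellahedron k).cls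

/-- The classes of the nestohedra on `B(Γ, k + 1)`. -/
noncomputable def gammaSeq (k : ℕ) : PolytopeAlg := (nestohedron (gammaBuildingSet (k + 1))).cls

/-- The classes of the nestohedra on `B(P, k + 2)`. -/
noncomputable def masSeq (k : ℕ) : PolytopeAlg := (masPolytope (k + 2)).cls

/-- The sequence with a single `1`, at the index `r`. -/
noncomputable def deltaSeq (r k : ℕ) : PolytopeAlg := if k = r then 1 else 0

theorem cls_point : Polytope.point.cls = 1 := map_one (MonoidAlgebra.of ℚ CombType)

theorem cls_permutohedron_zero : (permutohedron 0).cls = 1 := by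
  have huniq : ∀ F : (permutohedron 0).Face, F = ⊤ := by
    have key : ∀ P : Polytope, P = simplexSum (graphBuildingSet (⊤ : SimpleGraph (Fin (0 + 1)))
        SimpleGraph.connected_top).sets → ∀ F : P.Face, F = ⊤ := by
      rintro _ rfl F
      obtain ⟨w, rfl⟩ := faceOf_surjective _ F
      rw [← faceOf_zero]
      refine refines_congr_argmin fun T _ => argmin_congr fun i _ j _ => ?_
      have hij : i = j := Fin.ext (by omega)
      simp [hij]
    exact key _ (nestohedron_eq_simplexSum _)
  rw [← cls_point]
  refine congrArg (MonoidAlgebra.of ℚ CombType) (Quotient.sound ⟨?_⟩)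
  have : Unique (permutohedron 0).Face := ⟨⟨⊤⟩, huniq⟩
  exact OrderIso.ofUnique _ _

variable {V : Type} [Fintype V] [DecidableEq V]

set_option linter.unusedSectionVars false

theorem cls_completeFam_card {W : Finset V} (hW : W.Nonempty) :
    (simplexSum (completeFam W)).cls = peCardSeq W.card := by
  obtain ⟨k, hk⟩ := Nat.exists_eq_succ_of_ne_zero hW.card_pos.ne'
  rw [cls_completeFam hk, hk]
  rfl

/-- Extension by zero to the full powerset allows splitting by the distinguished vertices in `S`. -/
theorem sum_erase_eq_sum_powerset {F : Finset (Finset V)} {W : Finset V} (hF : ∀ S ∈ F, S ⊆ W)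
    (g : Finset V → PolytopeAlg) :
    ∑ S ∈ F.erase W, g S = ∑ S ∈ W.powerset, if S ∈ F.erase W then g S else 0 := by
  rw [← Finset.sum_filter]
  refine Finset.sum_congr ?_ fun _ _ => rfl
  ext S
  rw [Finset.mem_filter, Finset.mem_powerset]
  exact ⟨fun h => ⟨hF S (Finset.mem_of_mem_erase h), h⟩, fun h => h.2⟩

/-- The four terms come from `S = J`, `J ∪ {b}`, `J ∪ {a}` and `J ∪ {a, b}`, in this order. A set
with `b` but not `a` must be `{b}`, hence `deltaSeq 0`. The value `peCardSeq 0 = 0` discards `S = ∅`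
in the first term and `S = W` in the last. -/
theorem facetOp_gammaFam {a b : V} {M : Finset V} (hab : a ≠ b) (ha : a ∉ M) (hb : b ∉ M)
    (h : IsBuilding (gammaFam a b (insert a (insert b M))) (insert a (insert b M))) :
    facetOp (simplexSum (gammaFam a b (insert a (insert b M)))).cls =
      ∑ J ∈ M.powerset, (peCardSeq J.card * gammaSeq (M.card - J.card) +
        deltaSeq 0 J.card * peSeq (M.card - J.card) +
        (peSeq J.card * peSeq (M.card - J.card) +
          gammaSeq J.card * peCardSeq (M.card - J.card))) := by
  have haM : a ∉ insert b M := by simp [hab, ha]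
  rw [h.facetOp_cls, sum_erase_eq_sum_powerset h.subset, Finset.sum_powerset_insert haM,
    Finset.sum_powerset_insert hb, Finset.sum_powerset_insert hb, ← Finset.sum_add_distrib,
    ← Finset.sum_add_distrib, ← Finset.sum_add_distrib]
  set W := insert a (insert b M) with hW
  have hWa : a ∈ W := by simp [hW]
  have hWb : b ∈ W := by simp [hW]
  have hMW : M ⊆ W := (Finset.subset_insert _ _).trans (Finset.subset_insert _ _)
  have hWc : W.card = M.card + 2 := by
    rw [hW, Finset.card_insert_of_notMem haM, Finset.card_insert_of_notMem hb]
  refine Finset.sum_congr rfl fun J hJ => ?_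
  have hJM := Finset.mem_powerset.1 hJ
  have hJc := Finset.card_le_card hJM
  have haJ : a ∉ J := fun h => ha (hJM h)
  have hbJ : b ∉ J := fun h => hb (hJM h)
  have hJW : J ⊆ W := hJM.trans hMW
  have hbW : insert b J ⊆ W := Finset.insert_subset hWb hJW
  have haW : insert a J ⊆ W := Finset.insert_subset hWa hJW
  have habW : insert a (insert b J) ⊆ W := Finset.insert_subset hWa hbW
  have cb : (insert b J).card = J.card + 1 := Finset.card_insert_of_notMem hbJ
  have ca : (insert a J).card = J.card + 1 := Finset.card_insert_of_notMem haJ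
  have cab : (insert a (insert b J)).card = J.card + 2 := by
    rw [Finset.card_insert_of_notMem (by simp [hab, haJ]), cb]
  have cdiff : ∀ S ⊆ W, (W \ S).card = M.card + 2 - S.card := fun S hS => by
    rw [Finset.card_sdiff_of_subset hS, hWc]
  congr 1
  · congr 1
    · rcases J.eq_empty_or_nonempty with rfl | hne
      · rw [if_neg, Finset.card_empty, peCardSeq, zero_mul]
        exact fun h' => Finset.not_nonempty_empty (h.nonempty _ (Finset.mem_of_mem_erase h'))
      · have hJF : J ∈ gammaFam a b W := mem_gammaFam.2 ⟨hJW, Or.inr (Or.inl ⟨hne, hbJ⟩)⟩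
        rw [if_pos (Finset.mem_erase.2 ⟨by rintro rfl; exact haJ hWa, hJF⟩),
          restrict_gammaFam_of_notMem hJW hbJ, cls_completeFam_card hne,
          contract_gammaFam h hJF haJ hbJ, cls_gammaFam (n := M.card - J.card)
            (by rw [cdiff _ hJW]; omega) (by simp [hWa, haJ]) (by simp [hWb, hbJ]) hab, gammaSeq]
    · rcases J.eq_empty_or_nonempty with rfl | hne
      · have hbF : {b} ∈ gammaFam a b W := h.singleton_mem b hWb
        have hbW' : ({b} : Finset V) ≠ W := fun e => by
          rw [← e, Finset.mem_singleton] at hWa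
          exact hab hWa
        rw [insert_empty_eq, if_pos (Finset.mem_erase.2 ⟨hbW', hbF⟩),
          restrictFam_singleton h hWb, cls_completeFam (n := 0) (by simp),
          contract_gammaFam_complete h hbF (Or.inr (by simp)), cls_completeFam (n := M.card)
            (by rw [cdiff _ (by simpa using hWb)]; simp), cls_permutohedron_zero]
        simp [deltaSeq, peSeq]
      · rw [if_neg, deltaSeq, if_neg hne.card_pos.ne', zero_mul]
        intro h'
        have h' := (mem_gammaFam.1 (Finset.mem_of_mem_erase h')).2
        rw [cb] at h'
        have := hne.card_pos
        rcases h' with h' | h' | h'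
        · omega
        · exact h'.2 (by simp)
        · simp [hab, haJ] at h'
  · congr 1
    · have haF : insert a J ∈ gammaFam a b W :=
        mem_gammaFam.2 ⟨haW, Or.inr (Or.inl ⟨by simp, by simp [hab.symm, hbJ]⟩)⟩
      have haW' : insert a J ≠ W := fun e => by
        rw [← e] at hWb
        simp [hab.symm, hbJ] at hWb
      rw [if_pos (Finset.mem_erase.2 ⟨haW', haF⟩), restrict_gammaFam_of_notMem haW
        (by simp [hab.symm, hbJ]), cls_completeFam ca,
        contract_gammaFam_complete h haF (Or.inl (by simp)), cls_completeFam
          (n := M.card - J.card) (by rw [cdiff _ haW, ca]; omega), peSeq, peSeq]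
    · have habF : insert a (insert b J) ∈ gammaFam a b W :=
        mem_gammaFam.2 ⟨habW, Or.inr (Or.inr ⟨by simp, by simp⟩)⟩
      by_cases hJ' : J = M
      · subst hJ'
        rw [if_neg, Nat.sub_self, peCardSeq, mul_zero]
        simp [hW]
      · have hlt : J.card < M.card := Finset.card_lt_card (hJM.ssubset_of_ne hJ')
        have hne : insert a (insert b J) ≠ W := fun e => by
          rw [← e] at hWc
          omega
        rw [if_pos (Finset.mem_erase.2 ⟨hne, habF⟩), restrict_gammaFam habW,
          cls_gammaFam cab (by simp) (by simp) hab,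
          contract_gammaFam_complete h habF (Or.inl (by simp)), cls_completeFam_card
            (Finset.card_pos.1 (by rw [cdiff _ habW, cab]; omega)), cdiff _ habW, cab, gammaSeq]
        congr 2
        omega

-- The terms come from adjoining to `J`, in order, the sets `∅`, `{b}`, `{c}`, `{c, b}`, `{a}`, `{a,
-- b}`, `{a, c}`, `{a, c, b}`. Without `a` only singletons are members, which accounts for the
-- sequences `deltaSeq` and the first `0`. A set with `a` and `b` but not `c` is never a member,
-- which is the second `0`. Again `peCardSeq 0 = 0` discards `S = W`.
set_option maxHeartbeats 1600000 in
theorem facetOp_masFam {a b c : V} {M : Finset V} (hac : a ≠ c) (hab : a ≠ b) (hcb : c ≠ b)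
    (ha : a ∉ M) (hc : c ∉ M) (hb : b ∉ M)
    (h : IsBuilding (masFam a c b (insert a (insert c (insert b M))))
      (insert a (insert c (insert b M)))) :
    facetOp (simplexSum (masFam a c b (insert a (insert c (insert b M))))).cls =
      ∑ J ∈ M.powerset, (deltaSeq 1 J.card * masSeq (M.card - J.card) +
        deltaSeq 0 J.card * stSeq (M.card - J.card + 1) +
        (deltaSeq 0 J.card * stSeq (M.card - J.card + 1) + 0) +
        (stSeq J.card * gammaSeq (M.card - J.card) + 0 +
        (stSeq (J.card + 1) * peSeq (M.card - J.card) +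
          masSeq J.card * peCardSeq (M.card - J.card)))) := by
  have hcM : c ∉ insert b M := by simp [hcb, hc]
  have haM : a ∉ insert c (insert b M) := by simp [hab, ha, hac]
  rw [h.facetOp_cls, sum_erase_eq_sum_powerset h.subset, Finset.sum_powerset_insert haM,
    Finset.sum_powerset_insert hcM, Finset.sum_powerset_insert hcM, Finset.sum_powerset_insert hb,
    Finset.sum_powerset_insert hb, Finset.sum_powerset_insert hb, Finset.sum_powerset_insert hb]
  simp only [← Finset.sum_add_distrib]
  set W := insert a (insert c (insert b M)) with hW
  have hWa : a ∈ W := by simp [hW]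
  have hWb : b ∈ W := by simp [hW]
  have hWc : c ∈ W := by simp [hW]
  have hMW : M ⊆ W := fun x hx => by simp [hW, hx]
  have hWcard : W.card = M.card + 3 := by
    rw [hW, Finset.card_insert_of_notMem haM, Finset.card_insert_of_notMem hcM,
      Finset.card_insert_of_notMem hb]
  refine Finset.sum_congr rfl fun J hJ => ?_
  have hJM := Finset.mem_powerset.1 hJ
  have hJc := Finset.card_le_card hJM
  have haJ : a ∉ J := fun h => ha (hJM h)
  have hbJ : b ∉ J := fun h => hb (hJM h)
  have hcJ : c ∉ J := fun h => hc (hJM h)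
  have hJW : J ⊆ W := hJM.trans hMW
  have haW : insert a J ⊆ W := Finset.insert_subset hWa hJW
  have hacW : insert a (insert c J) ⊆ W :=
    Finset.insert_subset hWa (Finset.insert_subset hWc hJW)
  have hacbW : insert a (insert c (insert b J)) ⊆ W :=
    Finset.insert_subset hWa (Finset.insert_subset hWc (Finset.insert_subset hWb hJW))
  have ca : (insert a J).card = J.card + 1 := Finset.card_insert_of_notMem haJ
  have cb : (insert b J).card = J.card + 1 := Finset.card_insert_of_notMem hbJ
  have cc : (insert c J).card = J.card + 1 := Finset.card_insert_of_notMem hcJ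
  have cac : (insert a (insert c J)).card = J.card + 2 := by
    rw [Finset.card_insert_of_notMem (by simp [hac, haJ]), cc]
  have cab : (insert a (insert b J)).card = J.card + 2 := by
    rw [Finset.card_insert_of_notMem (by simp [hab, haJ]), cb]
  have ccb : (insert c (insert b J)).card = J.card + 2 := by
    rw [Finset.card_insert_of_notMem (by simp [hcb, hcJ]), cb]
  have cacb : (insert a (insert c (insert b J))).card = J.card + 3 := by
    rw [Finset.card_insert_of_notMem (by simp [hac, hab, haJ]), ccb]
  have cdiff : ∀ S ⊆ W, (W \ S).card = M.card + 3 - S.card := fun S hS => by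
    rw [Finset.card_sdiff_of_subset hS, hWcard]
  have hneW : ∀ S : Finset V, S.card < M.card + 3 → S ≠ W := fun S hS e => by
    rw [e, hWcard] at hS
    exact lt_irrefl _ hS
  have hout : ∀ S : Finset V, S.card ≠ 1 → a ∉ S → S ∉ (masFam a c b W).erase W := by
    intro S h1 h2 h3
    have := (mem_masFam.1 (Finset.mem_of_mem_erase h3)).2
    tauto
  congr 1
  · congr 1
    · congr 1
      · by_cases h1 : J.card = 1
        · have hJF : J ∈ masFam a c b W := mem_masFam.2 ⟨hJW, Or.inl h1⟩
          rw [if_pos (Finset.mem_erase.2 ⟨hneW J (by omega), hJF⟩), contract_masFam h hJF haJ hcJ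
            hbJ, cls_masFam (m := M.card - J.card) (by rw [cdiff _ hJW]; omega) (by simp [hWa, haJ])
            (by simp [hWc, hcJ]) (by simp [hWb, hbJ]) hac hab hcb, restrict_masFam hJW]
          obtain ⟨j, rfl⟩ := Finset.card_eq_one.1 h1
          rw [masFam_singleton, cls_completeFam (n := 0) (by simp), cls_permutohedron_zero,
            deltaSeq, if_pos (by simp), masSeq]
        · rw [if_neg (hout J h1 haJ), deltaSeq, if_neg h1, zero_mul]
      · rcases J.eq_empty_or_nonempty with rfl | hne
        · have hbF : {b} ∈ masFam a c b W := h.singleton_mem b hWb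
          rw [insert_empty_eq, if_pos (Finset.mem_erase.2 ⟨hneW _ (by simp), hbF⟩),
            contract_masFam_star h hbF (by simp [hab]) (Or.inr (by simp [hcb])),
            cls_starFam (n := M.card + 1) (by rw [cdiff _ (by simpa using hWb)]; simp)
              (by simp [hWa, hab]), restrict_masFam (by simpa using hWb), masFam_singleton,
            cls_completeFam (n := 0) (by simp), cls_permutohedron_zero]
          simp [deltaSeq, stSeq]
        · have := hne.card_pos
          rw [if_neg (hout _ (by omega) (by simp [hab, haJ])), deltaSeq, if_neg this.ne', zero_mul]
    · congr 1
      · rcases J.eq_empty_or_nonempty with rfl | hne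
        · have hcF : {c} ∈ masFam a c b W := h.singleton_mem c hWc
          rw [insert_empty_eq, if_pos (Finset.mem_erase.2 ⟨hneW _ (by simp), hcF⟩),
            contract_masFam_star h hcF (by simp [hac]) (Or.inl (by simp [hcb.symm])),
            cls_starFam (n := M.card + 1) (by rw [cdiff _ (by simpa using hWc)]; simp)
              (by simp [hWa, hac]), restrict_masFam (by simpa using hWc), masFam_singleton,
            cls_completeFam (n := 0) (by simp), cls_permutohedron_zero]
          simp [deltaSeq, stSeq]
        · have := hne.card_pos
          rw [if_neg (hout _ (by omega) (by simp [hac, haJ])), deltaSeq, if_neg this.ne', zero_mul]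
      · rw [if_neg (hout _ (by omega) (by simp [hac, hab, haJ]))]
  · congr 1
    · congr 1
      · have haF : insert a J ∈ masFam a c b W := mem_masFam.2 ⟨haW, Or.inr (Or.inr
          ⟨by simp, by simp [hac.symm, hcJ], by simp [hab.symm, hbJ]⟩)⟩
        rw [if_pos (Finset.mem_erase.2 ⟨hneW _ (by omega), haF⟩), restrict_masFam haW,
          masFam_eq_starFam (by simp [hab.symm, hbJ]), cls_starFam ca (by simp),
          contract_masFam_gamma h haF (by simp) (by simp [hac.symm, hcJ])
            (by simp [hab.symm, hbJ]),
          cls_gammaFam (n := M.card - J.card) (by rw [cdiff _ haW, ca]; omega)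
            (by simp [hWc, hac.symm, hcJ]) (by simp [hWb, hab.symm, hbJ]) hcb, stSeq, gammaSeq]
      · rw [if_neg]
        intro h'
        have h' := (mem_masFam.1 (Finset.mem_of_mem_erase h')).2
        rw [cab] at h'
        rcases h' with h' | h' | h'
        · omega
        · simp [hac.symm, hcb, hcJ] at h'
        · exact h'.2.2 (by simp)
    · congr 1
      · have hacF : insert a (insert c J) ∈ masFam a c b W :=
          mem_masFam.2 ⟨hacW, Or.inr (Or.inl ⟨by simp, by simp⟩)⟩
        rw [if_pos (Finset.mem_erase.2 ⟨hneW _ (by omega), hacF⟩), restrict_masFam hacW,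
          masFam_eq_starFam (by simp [hab.symm, hcb.symm, hbJ]), cls_starFam cac (by simp),
          contract_masFam_complete h hacF (by simp) (by simp),
          cls_completeFam (n := M.card - J.card) (by rw [cdiff _ hacW, cac]; omega), stSeq, peSeq]
      · have hF : insert a (insert c (insert b J)) ∈ masFam a c b W :=
          mem_masFam.2 ⟨hacbW, Or.inr (Or.inl ⟨by simp, by simp⟩)⟩
        by_cases hJ' : J = M
        · subst hJ'
          rw [if_neg, Nat.sub_self, peCardSeq, mul_zero]
          simp [hW]
        · have hlt : J.card < M.card := Finset.card_lt_card (hJM.ssubset_of_ne hJ')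
          rw [if_pos (Finset.mem_erase.2 ⟨hneW _ (by omega), hF⟩), restrict_masFam hacbW,
            cls_masFam cacb (by simp) (by simp) (by simp) hac hab hcb,
            contract_masFam_complete h hF (by simp) (by simp), cls_completeFam_card
              (Finset.card_pos.1 (by rw [cdiff _ hacbW, cacb]; omega)), cdiff _ hacbW, cacb, masSeq]
          congr 2
          omega

end sequences

/-! ### The segment and the point. -/

section segment

/-- The face of the unit interval on which `x ↦ d x` is minimal. -/
def segmentFaceSet (d : ℝ) : Set ℝ :=
  {x ∈ Set.Icc (0 : ℝ) 1 | ∀ y ∈ Set.Icc (0 : ℝ) 1, d * x ≤ d * y}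

/-- The face of the unit interval on which `x ↦ d x` is minimal, as a face of a polytope. -/
noncomputable def segmentFace (d : ℝ) : Polytope.segment.Face :=
  ⟨segmentFaceSet d, LinearMap.mulLeft ℝ d, rfl⟩

theorem segmentFace_surjective : Function.Surjective segmentFace := by
  rintro ⟨F, l, rfl⟩
  have key : ∀ l : ℝ →ₗ[ℝ] ℝ, ∃ d : ℝ, {x ∈ Set.Icc (0 : ℝ) 1 | ∀ y ∈ Set.Icc (0 : ℝ) 1,
      d * x ≤ d * y} = {x ∈ Set.Icc (0 : ℝ) 1 | ∀ y ∈ Set.Icc (0 : ℝ) 1, l x ≤ l y} := by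
    intro l
    have h : ∀ x, l x = l 1 * x := fun x => by
      have := l.map_smul x 1
      simpa [mul_comm] using this
    refine ⟨l 1, Set.ext fun x => and_congr_right fun _ => forall₂_congr fun y _ => ?_⟩
    rw [h x, h y]
  obtain ⟨d, hd⟩ := key l
  exact ⟨d, Subtype.ext hd⟩

theorem mem_segmentFaceSet {d x : ℝ} : x ∈ segmentFaceSet d ↔
    x ∈ Set.Icc (0 : ℝ) 1 ∧ ∀ y ∈ Set.Icc (0 : ℝ) 1, d * x ≤ d * y := Iff.rfl

theorem zero_mem_segmentFaceSet {d : ℝ} : (0 : ℝ) ∈ segmentFaceSet d ↔ 0 ≤ d := by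
  rw [mem_segmentFaceSet]
  refine ⟨fun h => by simpa using h.2 1 (by simp), fun h => ⟨by simp, fun y hy => ?_⟩⟩
  rw [mul_zero]
  exact mul_nonneg h hy.1

theorem one_mem_segmentFaceSet {d : ℝ} : (1 : ℝ) ∈ segmentFaceSet d ↔ d ≤ 0 := by
  rw [mem_segmentFaceSet]
  refine ⟨fun h => by simpa using h.2 0 (by simp), fun h => ⟨by simp, fun y hy => ?_⟩⟩
  nlinarith [hy.2]

/-- A face of the segment is determined by the endpoints in it: `0` belongs to it for slopes `≥ 0`
and `1` for slopes `≤ 0`. -/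
theorem segmentFace_le {d d' : ℝ} :
    segmentFace d ≤ segmentFace d' ↔ (0 ≤ d → 0 ≤ d') ∧ (d ≤ 0 → d' ≤ 0) := by
  change segmentFaceSet d ⊆ segmentFaceSet d' ↔ _
  constructor
  · intro h
    exact ⟨fun hd => zero_mem_segmentFaceSet.1 (h (zero_mem_segmentFaceSet.2 hd)),
      fun hd => one_mem_segmentFaceSet.1 (h (one_mem_segmentFaceSet.2 hd))⟩
  · rintro ⟨h0, h1⟩ x hx
    obtain ⟨hx, hx'⟩ := mem_segmentFaceSet.1 hx
    refine mem_segmentFaceSet.2 ⟨hx, fun y hy => ?_⟩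
    have e0 := hx' 0 (by simp)
    have e1 := hx' 1 (by simp)
    have hx0 : (0 : ℝ) ≤ x := hx.1
    have hx1 : x ≤ (1 : ℝ) := hx.2
    rcases lt_trichotomy d 0 with hd | rfl | hd
    · have hx : x = (1 : ℝ) := by nlinarith
      have := h1 hd.le
      rw [hx]
      nlinarith [hy.2]
    · have : d' = 0 := le_antisymm (h1 le_rfl) (h0 le_rfl)
      simp [this]
    · have hx : x = (0 : ℝ) := by nlinarith
      have := h0 hd.le
      rw [hx]
      nlinarith [hy.1]

theorem segmentFace_zero : segmentFace 0 = ⊤ := by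
  refine top_unique ?_
  obtain ⟨d, hd⟩ := segmentFace_surjective ⊤
  rw [← hd, segmentFace_le]
  simp

/-- On both sides the face depends only on a sign, that of the slope or of `w 1 - w 0`. It follows
that `P_Γ^1`, a segment by convention, fits the recursion as the nestohedron on `B(Γ, 1)`. -/
theorem cls_segment : Polytope.segment.cls = gammaSeq 0 := by
  rw [gammaSeq, nestohedron_eq_simplexSum]
  refine congrArg (MonoidAlgebra.of ℚ CombType) (Quotient.sound ⟨?_⟩)
  refine orderIsoOfSurjective (L := Fin 2 → ℝ) (fun w => segmentFace (w 1 - w 0))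
    (faceOf (gammaBuildingSet 1).sets) ?_ (faceOf_surjective _) ?_
  · intro F
    obtain ⟨d, rfl⟩ := segmentFace_surjective F
    exact ⟨![0, d], by simp⟩
  · intro w w'
    rw [segmentFace_le, faceOf_le]
    simp only [sub_nonneg, sub_nonpos]
    constructor
    · rintro ⟨h0, h1⟩ T - i hi
      obtain ⟨hi, hm⟩ := mem_argmin.1 hi
      refine mem_argmin.2 ⟨hi, fun j hj => ?_⟩
      have := hm j hj
      fin_cases i <;> fin_cases j
      · exact le_rfl
      · exact h0 this
      · exact h1 this
      · exact le_rfl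
    · intro h
      have h := h _ (gammaBuildingSet 1).univ_mem
      refine ⟨fun h0 => ?_, fun h1 => ?_⟩
      · refine (mem_argmin.1 (h (mem_argmin.2 ⟨Finset.mem_univ 0, fun j _ => ?_⟩))).2 1
          (Finset.mem_univ _)
        fin_cases j
        · exact le_rfl
        · exact h0
      · refine (mem_argmin.1 (h (mem_argmin.2 ⟨Finset.mem_univ 1, fun j _ => ?_⟩))).2 0
          (Finset.mem_univ _)
        fin_cases j
        · exact h1
        · exact le_rfl

theorem dim_segment : Polytope.segment.dim = 1 := by
  change Module.finrank ℝ (vectorSpan ℝ (Set.Icc (0 : ℝ) 1)) = 1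
  have h : vectorSpan ℝ (Set.Icc (0 : ℝ) 1) = ⊤ := by
    rw [eq_top_iff]
    intro x _
    have h1 : (1 : ℝ) -ᵥ (0 : ℝ) ∈ vectorSpan ℝ (Set.Icc (0 : ℝ) 1) :=
      vsub_mem_vectorSpan ℝ (by simp) (by simp)
    have := Submodule.smul_mem _ x h1
    simpa using this
  rw [h, finrank_top, Module.finrank_self]

theorem dim_point : Polytope.point.dim = 0 := by
  change Module.finrank ℝ (vectorSpan ℝ ({0} : Set ℝ)) = 0
  rw [vectorSpan_singleton, finrank_bot]

theorem isSimple_point : Polytope.point.IsSimple := by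
  intro v _
  have : IsEmpty Polytope.point.Facet :=
    ⟨fun F => F.2.1 (Subsingleton.elim (α := Polytope.point.Face) _ _)⟩
  rw [dim_point, Set.eq_empty_of_isEmpty {F : Polytope.point.Facet | v ∈ F.1.1}, Set.ncard_empty]

/-- Both endpoints are treated at once: `e` is the sign of the slopes minimal at `v`, namely `1` for
the endpoint `0` and `-1` for the endpoint `1`. -/
theorem ncard_facets_segment {v e : ℝ} (he : e = 1 ∨ e = -1)
    (hv : ∀ d, v ∈ segmentFaceSet d ↔ 0 ≤ e * d) :
    {F : Polytope.segment.Facet | v ∈ F.1.1}.ncard = 1 := by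
  have hco : IsCoatom (segmentFace e) := by
    refine isCoatom_iff_ge_of_le.2 ⟨?_, fun G hG hle => ?_⟩
    · rw [← segmentFace_zero]
      intro h
      have := segmentFace_le.1 h.ge
      rcases he with rfl | rfl <;> norm_num at this
    · obtain ⟨d, rfl⟩ := segmentFace_surjective G
      rw [segmentFace_le] at hle ⊢
      have hd : d ≠ 0 := by
        rintro rfl
        exact hG segmentFace_zero
      rcases he with rfl | rfl <;> norm_num at hle ⊢ <;> exact lt_of_le_of_ne hle (by tauto)
  refine Set.ncard_eq_one.2 ⟨⟨segmentFace e, hco⟩, ?_⟩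
  ext ⟨G, hG⟩
  obtain ⟨d, rfl⟩ := segmentFace_surjective G
  have hd : d ≠ 0 := by
    rintro rfl
    exact hG.1 segmentFace_zero
  constructor
  · intro h
    have h : 0 ≤ e * d := (hv d).1 h
    refine Subtype.ext (le_antisymm ?_ ?_) <;> refine segmentFace_le.2 ?_ <;>
      rcases he with rfl | rfl <;> norm_num at h ⊢ <;>
      first | exact lt_of_le_of_ne h (by tauto) | exact h
  · intro h
    have h : segmentFaceSet d = segmentFaceSet e := congrArg (fun G => G.1.1) h
    change v ∈ segmentFaceSet d
    rw [h, hv]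
    exact mul_self_nonneg e

theorem isSimple_segment : Polytope.segment.IsSimple := by
  intro v hv
  rw [dim_segment]
  have key : ∀ v : ℝ, v ∈ (Set.Icc (0 : ℝ) 1).extremePoints ℝ → v = 0 ∨ v = 1 := by
    intro v hv
    rw [← segment_eq_Icc zero_le_one, ← convexHull_pair] at hv
    simpa using extremePoints_convexHull_subset hv
  rcases key v hv with h | h
  · refine ncard_facets_segment (v := v) (e := 1) (Or.inl rfl) fun d => ?_
    rw [h, zero_mem_segmentFaceSet, one_mul]
  · refine ncard_facets_segment (v := v) (e := -1) (Or.inr rfl) fun d => ?_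
    rw [h, one_mem_segmentFaceSet]
    simp

end segment

/-! ### Exponential generating series and the one-parameter identities. -/

section egf

/-- The exponential generating series of a sequence. -/
noncomputable def egf (u : ℕ → PolytopeAlg) : PowerSeries PolytopeAlg :=
  PowerSeries.mk fun n => (1 / (n.factorial : ℚ)) • u n

theorem coeff_egf (u : ℕ → PolytopeAlg) (n : ℕ) :
    PowerSeries.coeff n (egf u) = (1 / (n.factorial : ℚ)) • u n :=
  PowerSeries.coeff_mk _ _

/-- Grouping the subsets `J` by size produces the binomial coefficients of the product of two
exponential generating series. -/
theorem coeff_egf_mul {V : Type} {M : Finset V} {m : ℕ} (hM : M.card = m)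
    (u v : ℕ → PolytopeAlg) : PowerSeries.coeff m (egf u * egf v) =
      (1 / (m.factorial : ℚ)) • ∑ J ∈ M.powerset, u J.card * v (M.card - J.card) := by
  subst hM
  rw [PowerSeries.coeff_mul, Finset.Nat.sum_antidiagonal_eq_sum_range_succ_mk,
    Finset.sum_powerset_apply_card (fun k => u k * v (M.card - k)), Finset.smul_sum]
  refine Finset.sum_congr rfl fun k hk => ?_
  have hk : k ≤ M.card := Nat.lt_succ_iff.1 (Finset.mem_range.1 hk)
  rw [coeff_egf, coeff_egf, smul_mul_smul_comm, ← Nat.cast_smul_eq_nsmul ℚ, smul_smul]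
  congr 1
  rw [Nat.cast_choose ℚ hk]
  have h1 := Nat.factorial_pos k
  have h2 := Nat.factorial_pos (M.card - k)
  have h3 := Nat.factorial_pos M.card
  field_simp

theorem egf_deltaSeq_zero : egf (deltaSeq 0) = 1 := by
  ext n
  rw [coeff_egf, PowerSeries.coeff_one, deltaSeq]
  split_ifs with h
  · simp [h]
  · simp

theorem egf_deltaSeq_one : egf (deltaSeq 1) = PowerSeries.X := by
  ext n
  rw [coeff_egf, PowerSeries.coeff_X, deltaSeq]
  split_ifs with h
  · simp [h]
  · simp

theorem derivative_egf (u : ℕ → PolytopeAlg) :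
    PowerSeries.derivative PolytopeAlg (egf u) = egf fun n => u (n + 1) :=
  derivative_mk_expCoeff u

/-- The exponent `s + 1` is the size of the ground set, which is why the sequence is shifted and
starts with `0`; differentiating restores the index by dimension. -/
theorem peSeries_eq : peSeries = egf peCardSeq := by
  ext n
  rw [peSeries, genSeries, pow_one, coeff_egf]
  cases n with
  | zero => simp [peCardSeq]
  | succ n => rw [PowerSeries.coeff_succ_X_mul, PowerSeries.coeff_mk]; rfl

theorem ddx_peSeries : ddx peSeries = egf peSeq := by
  rw [ddx, peSeries_eq, derivative_egf]
  rfl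

theorem stSeries_eq : stSeries = egf stSeq := by
  rw [stSeries, genSeries, pow_zero, one_mul]
  rfl

theorem cls_gammaPolytope (n : ℕ) : (gammaPolytope (n + 1)).cls = gammaSeq n := by
  cases n with
  | zero => exact cls_segment
  | succ n => rfl

theorem gammaSeries_eq : gammaSeries = egf gammaSeq := by
  rw [gammaSeries, genSeries, pow_zero, one_mul]
  simp only [cls_gammaPolytope]
  rfl

theorem masSeries_eq : masSeries = PowerSeries.X ^ 2 * egf masSeq := rfl

theorem facetOp_gammaSeq (m : ℕ) : ∃ M : Finset (Fin (m + 2)), M.card = m ∧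
    facetOp (gammaSeq m) =
      ∑ J ∈ M.powerset, (peCardSeq J.card * gammaSeq (M.card - J.card) +
        deltaSeq 0 J.card * peSeq (M.card - J.card) +
        (peSeq J.card * peSeq (M.card - J.card) +
          gammaSeq J.card * peCardSeq (M.card - J.card))) := by
  have hab : (0 : Fin (m + 2)) ≠ Fin.last (m + 1) := Fin.last_pos.ne
  set M : Finset (Fin (m + 2)) := Finset.univ \ {0, Fin.last (m + 1)} with hM
  have hc : M.card = m := by
    rw [hM, Finset.card_sdiff_of_subset (Finset.subset_univ _), Finset.card_pair hab]
    simp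
  have hW : insert 0 (insert (Fin.last (m + 1)) M) = Finset.univ := by
    ext i
    simp only [hM, Finset.mem_insert, Finset.mem_sdiff, Finset.mem_univ, Finset.mem_singleton]
    tauto
  have hs : (gammaBuildingSet (m + 1)).sets = gammaFam 0 (Fin.last (m + 1)) Finset.univ := by
    ext S
    rw [mem_gammaBuildingSet, mem_gammaFam]
    simp
  refine ⟨M, hc, ?_⟩
  have hB := (gammaBuildingSet (m + 1)).isBuilding
  rw [gammaSeq, nestohedron_eq_simplexSum]
  rw [hs, ← hW] at hB ⊢
  exact facetOp_gammaFam hab (by simp [hM]) (by simp [hM]) hB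

theorem facetOp_masSeq (m : ℕ) : ∃ M : Finset (Fin (m + 2 + 1)), M.card = m ∧
    facetOp (masSeq m) =
      ∑ J ∈ M.powerset, (deltaSeq 1 J.card * masSeq (M.card - J.card) +
        deltaSeq 0 J.card * stSeq (M.card - J.card + 1) +
        (deltaSeq 0 J.card * stSeq (M.card - J.card + 1) + 0) +
        (stSeq J.card * gammaSeq (M.card - J.card) + 0 +
        (stSeq (J.card + 1) * peSeq (M.card - J.card) +
          masSeq J.card * peCardSeq (M.card - J.card)))) := by
  have hab : (0 : Fin (m + 2 + 1)) ≠ Fin.last (m + 2) := Fin.last_pos.ne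
  have hac : (0 : Fin (m + 2 + 1)) ≠ 1 := by simp
  have hcb : (1 : Fin (m + 2 + 1)) ≠ Fin.last (m + 2) := by
    intro h
    have := congrArg Fin.val h
    simp at this
  set M : Finset (Fin (m + 2 + 1)) := Finset.univ \ {0, 1, Fin.last (m + 2)} with hM
  have hc : M.card = m := by
    rw [hM, Finset.card_sdiff_of_subset (Finset.subset_univ _), Finset.card_eq_three.2
      ⟨0, 1, Fin.last (m + 2), hac, hab, hcb, rfl⟩]
    simp
  have hW : insert 0 (insert 1 (insert (Fin.last (m + 2)) M)) = Finset.univ := by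
    ext i
    simp only [hM, Finset.mem_insert, Finset.mem_sdiff, Finset.mem_univ, Finset.mem_singleton]
    tauto
  have hs : (masBuildingSet m).sets = masFam 0 1 (Fin.last (m + 2)) Finset.univ := by
    ext S
    rw [mem_masBuildingSet, mem_masFam]
    simp
  refine ⟨M, hc, ?_⟩
  have hB := (masBuildingSet m).isBuilding
  rw [masSeq, masPolytope, nestohedron_eq_simplexSum]
  rw [hs, ← hW] at hB ⊢
  exact facetOp_masFam hac hab hcb (by simp [hM]) (by simp [hM]) (by simp [hM]) hB

/-- The two copies of `Pe · P_Γ` come from the `S` that avoid both `a` and `b` and from those that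
contain both; `Pe'` comes from `S = {b}`, and `Pe'²` from the `S` that contain `a` but not `b`. -/
theorem facetOpSeries_gammaSeries : facetOpSeries gammaSeries =
    2 * peSeries * gammaSeries + (1 + ddx peSeries) * ddx peSeries := by
  have h : facetOpSeries gammaSeries = egf peCardSeq * egf gammaSeq + egf (deltaSeq 0) * egf peSeq +
      (egf peSeq * egf peSeq + egf gammaSeq * egf peCardSeq) := by
    refine PowerSeries.ext fun m => ?_
    obtain ⟨M, hM, hf⟩ := facetOp_gammaSeq m
    rw [facetOpSeries, PowerSeries.coeff_mk, gammaSeries_eq, coeff_egf, map_smul, hf]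
    simp only [map_add, coeff_egf_mul hM, Finset.sum_add_distrib, smul_add]
  rw [h, egf_deltaSeq_zero, ddx_peSeries, peSeries_eq, gammaSeries_eq]
  ring

theorem facetOpSeries_X_pow_mul (k : ℕ) (f : PowerSeries PolytopeAlg) :
    facetOpSeries (PowerSeries.X ^ k * f) = PowerSeries.X ^ k * facetOpSeries f := by
  ext n
  rw [facetOpSeries, PowerSeries.coeff_mk, PowerSeries.coeff_X_pow_mul',
    PowerSeries.coeff_X_pow_mul']
  split_ifs
  · rw [facetOpSeries, PowerSeries.coeff_mk]
  · rw [map_zero]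

/-- Ordinary singletons give `x · P_Mas`, and the sets containing `a`, `b`, `c` give `Pe · P_Mas`.
The singletons `{b}` and `{c}` give `2 St'`, the sets `J ∪ {a}` give `St · P_Γ`, and the sets `J ∪
{a, c}` give `St' · Pe'`. -/
theorem facetOpSeries_masSeries : facetOpSeries masSeries =
    (PowerSeries.X + peSeries) * masSeries + PowerSeries.X ^ 2 *
      (2 * ddx stSeries + stSeries * gammaSeries + ddx stSeries * ddx peSeries) := by
  have h : facetOpSeries (egf masSeq) = egf (deltaSeq 1) * egf masSeq +
      egf (deltaSeq 0) * egf (fun n => stSeq (n + 1)) +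
      egf (deltaSeq 0) * egf (fun n => stSeq (n + 1)) +
      (egf stSeq * egf gammaSeq + (egf (fun n => stSeq (n + 1)) * egf peSeq +
        egf masSeq * egf peCardSeq)) := by
    refine PowerSeries.ext fun m => ?_
    obtain ⟨M, hM, hf⟩ := facetOp_masSeq m
    rw [facetOpSeries, PowerSeries.coeff_mk, coeff_egf, map_smul, hf]
    simp only [map_add, coeff_egf_mul hM, Finset.sum_add_distrib, smul_add, add_zero]
  rw [masSeries_eq, facetOpSeries_X_pow_mul, h, egf_deltaSeq_zero, egf_deltaSeq_one, ddx_peSeries,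
    ddx, stSeries_eq, derivative_egf, peSeries_eq, gammaSeries_eq]
  ring

end egf

/-! ### The exponential of `q d`, the Cauchy problems and the conclusion. -/

section twoParameter

/-- Polynomials in `q` as power series in `q`, coefficientwise for power series in `x`. -/
noncomputable def polyLift :
    PowerSeries (Polynomial PolytopeAlg) →+* PowerSeries (PowerSeries PolytopeAlg) :=
  PowerSeries.map Polynomial.coeToPowerSeries.ringHom

/-- The exponential of `q d`, coefficientwise for power series in `x`. -/
noncomputable def expLift :
    PowerSeries PolytopeAlg →+* PowerSeries (PowerSeries PolytopeAlg) :=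
  PowerSeries.map (expHom facetDerivation)

theorem coeff_polyLift (f : PowerSeries (Polynomial PolytopeAlg)) (n : ℕ) :
    PowerSeries.coeff n (polyLift f) = ((PowerSeries.coeff n f : Polynomial PolytopeAlg) :
      PowerSeries PolytopeAlg) :=
  PowerSeries.coeff_map _ _ _

theorem coeff_expLift (f : PowerSeries PolytopeAlg) (n : ℕ) :
    PowerSeries.coeff n (expLift f) = expSeries facetDerivation (PowerSeries.coeff n f) :=
  PowerSeries.coeff_map _ _ _

theorem polyLift_injective : Function.Injective polyLift := by
  intro f g h
  refine PowerSeries.ext fun n => Polynomial.coe_injective PolytopeAlg ?_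
  rw [← coeff_polyLift, ← coeff_polyLift, h]

theorem derivative_map_powerSeries {R S : Type*} [CommRing R] [CommRing S] (φ : R →+* S)
    (f : PowerSeries R) : PowerSeries.map φ (PowerSeries.derivative R f) =
      PowerSeries.derivative S (PowerSeries.map φ f) := by
  ext n
  simp [PowerSeries.coeff_derivative]

theorem polyLift_partialX {f : PowerSeries (Polynomial PolytopeAlg)} {g : PowerSeries PolytopeAlg}
    (h : polyLift f = expLift g) : polyLift (partialX f) = expLift (ddx g) := by
  rw [polyLift, expLift] at *
  rw [partialX, ddx, derivative_map_powerSeries, derivative_map_powerSeries, h]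

/-- This is `∂/∂q exp(q d) = exp(q d) d`, applied to each coefficient in `x`. -/
theorem polyLift_partialQ {f : PowerSeries (Polynomial PolytopeAlg)} {g : PowerSeries PolytopeAlg}
    (h : polyLift f = expLift g) : polyLift (partialQ f) = expLift (facetOpSeries g) := by
  refine PowerSeries.ext fun n => ?_
  have hn := congrArg (PowerSeries.coeff n) h
  rw [coeff_polyLift, coeff_expLift] at hn
  rw [coeff_polyLift, coeff_expLift, partialQ, facetOpSeries, PowerSeries.coeff_mk,
    PowerSeries.coeff_mk, ← PowerSeries.derivative_coe, hn, derivative_expSeries]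
  rfl

theorem atQZero_eq {f : PowerSeries (Polynomial PolytopeAlg)} {g : PowerSeries PolytopeAlg}
    (h : polyLift f = expLift g) : atQZero f = g := by
  refine PowerSeries.ext fun n => ?_
  have hn := congrArg (fun p => PowerSeries.coeff 0 (PowerSeries.coeff n p)) h
  simp only [coeff_polyLift, coeff_expLift, coeff_expSeries, Polynomial.coeff_coe,
    Polynomial.coeff_zero_eq_eval_zero] at hn
  rw [atQZero, PowerSeries.coeff_map, Polynomial.coe_evalRingHom, hn]
  simp

/-- The vanishing hypothesis says that the truncation at degree `n` loses nothing. -/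
theorem coe_qPolynomial {P : ℕ → Polytope} {n : ℕ}
    (h : ∀ k, n < k → facetOp^[k] (P n).cls = 0) :
    (qPolynomial P n : PowerSeries PolytopeAlg) = expSeries facetDerivation (P n).cls := by
  ext1 k
  rw [Polynomial.coeff_coe, coeff_expSeries, qPolynomial, Polynomial.finsetSum_coeff]
  simp only [Polynomial.coeff_C_mul_X_pow]
  rw [Finset.sum_ite_eq]
  split_ifs with hk
  · rfl
  · rw [Finset.mem_range] at hk
    have : facetDerivation^[k] (P n).cls = 0 := h k (by omega)
    rw [this, smul_zero]

/-- Only indices `n ≥ N` occur in the series, so vanishing is not asked of the members of the family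
before that. -/
theorem polyLift_genSeries₂ {P : ℕ → Polytope} (c : ℕ → ℚ) (N e : ℕ)
    (h : ∀ n k, N ≤ n → n < k → facetOp^[k] (P n).cls = 0) :
    polyLift (genSeries₂ c N e P) = expLift (genSeries c N e P) := by
  rw [genSeries₂, genSeries, map_mul, map_mul, map_pow, map_pow, polyLift, expLift,
    PowerSeries.map_X, PowerSeries.map_X]
  congr 1
  refine PowerSeries.ext fun s => ?_
  rw [PowerSeries.coeff_map, PowerSeries.coeff_map, PowerSeries.coeff_mk, PowerSeries.coeff_mk,
    map_rat_smul, map_rat_smul]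
  congr 1
  exact coe_qPolynomial fun k hk => h _ k (by omega) hk

theorem iterate_facetOp_nestohedron {V : Type} [Fintype V] [DecidableEq V] (B : BuildingSet V)
    {k : ℕ} (hk : Fintype.card V ≤ k) : facetOp^[k] (nestohedron B).cls = 0 := by
  rw [nestohedron_eq_simplexSum]
  exact iterate_facetOp_eq_zero B.isBuilding (by simpa using hk)

theorem iterate_facetOp_nestohedron_mem {V : Type} [Fintype V] [DecidableEq V] (B : BuildingSet V)
    (k : ℕ) : facetOp^[k] (nestohedron B).cls ∈ simplePolytopeRing := by
  rw [nestohedron_eq_simplexSum]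
  exact iterate_facetOp_mem B.isBuilding k

/-- The point has the type of `Pe^0`, so the result for nestohedra applies. -/
theorem iterate_facetOp_point_mem (k : ℕ) :
    facetOp^[k] Polytope.point.cls ∈ simplePolytopeRing := by
  rw [← cls_permutohedron_zero.trans cls_point.symm]
  exact iterate_facetOp_nestohedron_mem _ k

theorem iterate_facetOp_segment_mem (k : ℕ) :
    facetOp^[k] Polytope.segment.cls ∈ simplePolytopeRing := by
  rw [cls_segment]
  exact iterate_facetOp_nestohedron_mem _ k

theorem polyLift_peSeries₂ : polyLift peSeries₂ = expLift peSeries :=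
  polyLift_genSeries₂ _ _ _ fun _ _ _ hk =>
    iterate_facetOp_nestohedron _ (by rwa [Fintype.card_fin])

theorem polyLift_stSeries₂ : polyLift stSeries₂ = expLift stSeries :=
  polyLift_genSeries₂ _ _ _ fun _ _ _ hk =>
    iterate_facetOp_nestohedron _ (by rwa [Fintype.card_fin])

theorem polyLift_gammaSeries₂ : polyLift gammaSeries₂ = expLift gammaSeries :=
  polyLift_genSeries₂ _ _ _ fun n k hn hk => by
    obtain ⟨m, rfl⟩ := Nat.exists_eq_add_of_le' hn
    rw [cls_gammaPolytope]
    exact iterate_facetOp_nestohedron _ (by rwa [Fintype.card_fin])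

theorem polyLift_masSeries₂ : polyLift masSeries₂ = expLift masSeries :=
  polyLift_genSeries₂ _ _ _ fun n k hn hk => by
    obtain ⟨m, rfl⟩ := Nat.exists_eq_add_of_le' hn
    exact iterate_facetOp_nestohedron _ (by rwa [Fintype.card_fin])

theorem polyLift_X : polyLift PowerSeries.X = PowerSeries.X := PowerSeries.map_X _

theorem expLift_X : expLift PowerSeries.X = PowerSeries.X := PowerSeries.map_X _

/-- Polynomials embed into power series in `q`, where the identity is the image of the one-parameter
one under the ring homomorphism `expLift`. -/
theorem partialQ_gammaSeries₂ : partialQ gammaSeries₂ =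
    2 * peSeries₂ * gammaSeries₂ + partialX peSeries₂ * (1 + partialX peSeries₂) := by
  refine polyLift_injective ?_
  rw [polyLift_partialQ polyLift_gammaSeries₂, facetOpSeries_gammaSeries]
  simp only [map_add, map_mul, map_one, map_ofNat, polyLift_peSeries₂, polyLift_gammaSeries₂,
    polyLift_partialX polyLift_peSeries₂]
  ring

theorem partialQ_masSeries₂ : partialQ masSeries₂ =
    (PowerSeries.X + peSeries₂) * masSeries₂ + PowerSeries.X ^ 2 *
      (2 * partialX stSeries₂ + stSeries₂ * gammaSeries₂ +
        partialX stSeries₂ * partialX peSeries₂) := by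
  refine polyLift_injective ?_
  rw [polyLift_partialQ polyLift_masSeries₂, facetOpSeries_masSeries]
  simp only [map_add, map_mul, map_pow, map_ofNat, polyLift_peSeries₂, polyLift_gammaSeries₂,
    polyLift_stSeries₂, polyLift_masSeries₂, polyLift_partialX polyLift_peSeries₂,
    polyLift_partialX polyLift_stSeries₂, polyLift_X, expLift_X]

theorem simple_family_nestohedron {n : ℕ} (B : BuildingSet (Fin (n + 1))) :
    (nestohedron B).IsSimple ∧ (nestohedron B).dim = n ∧
      ∀ k : ℕ, facetOp^[k] (nestohedron B).cls ∈ simplePolytopeRing :=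
  ⟨isSimple_nestohedron B, by rw [dim_nestohedron, Fintype.card_fin]; rfl,
    iterate_facetOp_nestohedron_mem B⟩

end twoParameter

theorem theorem3p11 :
    -- the families consist of simple polytopes, `P^n` having dimension `n`, and all the
    -- coefficients `d^k P^n` belong to the ring of simple polytopes
    (∀ P ∈ ({permutohedron, stellahedron, gammaPolytope, masPolytope} : Set (ℕ → Polytope)),
      ∀ n : ℕ, (P n).IsSimple ∧ (P n).dim = n ∧
        ∀ k : ℕ, (facetOp^[k]) (P n).cls ∈ simplePolytopeRing) ∧
    -- the one-parameter identities
    facetOpSeries gammaSeries =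
      2 * peSeries * gammaSeries + (1 + ddx peSeries) * ddx peSeries ∧
    facetOpSeries masSeries =
      (PowerSeries.X + peSeries) * masSeries +
        PowerSeries.X ^ 2 *
          (2 * ddx stSeries + stSeries * gammaSeries + ddx stSeries * ddx peSeries) ∧
    -- the Cauchy problem for `P_Γ(q, x)`
    (partialQ gammaSeries₂ =
        2 * peSeries₂ * gammaSeries₂ + partialX peSeries₂ * (1 + partialX peSeries₂) ∧
      atQZero gammaSeries₂ = gammaSeries) ∧
    -- the Cauchy problem for `P_Mas(q, x)`
    (partialQ masSeries₂ =
        (PowerSeries.X + peSeries₂) * masSeries₂ +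
          PowerSeries.X ^ 2 *
            (2 * partialX stSeries₂ + stSeries₂ * gammaSeries₂ +
              partialX stSeries₂ * partialX peSeries₂) ∧
      atQZero masSeries₂ = masSeries) := by
  refine ⟨?_, facetOpSeries_gammaSeries, facetOpSeries_masSeries,
    ⟨partialQ_gammaSeries₂, atQZero_eq polyLift_gammaSeries₂⟩,
    ⟨partialQ_masSeries₂, atQZero_eq polyLift_masSeries₂⟩⟩
  rintro P (rfl | rfl | rfl | rfl) n
  · exact simple_family_nestohedron _
  · exact simple_family_nestohedron _
  · match n with
    | 0 => exact ⟨isSimple_point, dim_point, iterate_facetOp_point_mem⟩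
    | 1 => exact ⟨isSimple_segment, dim_segment, iterate_facetOp_segment_mem⟩
    | n + 2 => exact simple_family_nestohedron _
  · match n with
    | 0 => exact ⟨isSimple_point, dim_point, iterate_facetOp_point_mem⟩
    | 1 => exact ⟨isSimple_segment, dim_segment, iterate_facetOp_segment_mem⟩
    | n + 2 => exact simple_family_nestohedron _
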